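/- Let $k$ be an algebraically closed field. **Bocses.** A bocs $\mathfrak A=(\Gamma,\Omega)$ over $k$ consists of a $k$-algebra $\Gamma$ and a $\Gamma$-$\Gamma$-bimodule $\Omega$ on which $k$ acts centrally, with bimodule maps $\Omega\to\Omega\otimes_\Gamma\Omega$ (a coassociative comultiplication) and $\varepsilon:\Omega\to\Gamma$ (a two-sided counit). The category $R(\mathfrak A)$ has as objects the finite-dimensional left $\Gamma$-modules and as morphisms $M\to N$ the $\Gamma$-$\Gamma$-bimodule maps $\Omega\to\mathrm{Hom}_k(M,N)$ (equivalently, the $\Gamma$-linear maps $\Omega\otimes_\Gamma M\to N$). The composite of $\varphi:M\to N$ and $\psi:N\to E$ is $x\mapsto\sum\psi(x_{(1)})\varphi(x_{(2)})$, where $\sum x_{(1)}\otimes x_{(2)}$ is the comultiplication of $x$, and the identities are given by $\varepsilon$. **Layers.** A layer $L=(\Gamma';\omega;a_1,\dots,a_n;v_1,\dots,v_m)$ of $\mathfrak A$ consists of the following data. * An algebra $\Gamma'=\prod_P\Gamma'(P,P)$, a finite product over "vertices" $P$, with each factor isomorphic to $k$ (a trivial vertex) or to $k[\lambda,g_P(\lambda)^{-1}]$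 for some polynomial $g_P\ne0$ (a vertex carrying the parameter $\lambda$), together with an algebra map $\Gamma'\to\Gamma$. Write $e_P$ for the idempotent of $P$. * Solid arrows $a_i:P_i\to Q_i$, that is, elements $a_i=e_{Q_i}a_ie_{P_i}$ of $\Gamma$, which freely generate $\Gamma$ over $\Gamma'$. * A $\Gamma'$-$\Gamma'$-bimodule map $\omega:\Gamma'\to\Omega$ such that $\varepsilon\omega$ is the map $\Gamma'\to\Gamma$ and the comultiplication sends each $\omega(e_P)$ to $\omega(e_P)\otimes\omega(e_P)$. * Dotted arrows $v_j:P'_j\to Q'_j$, that is, elements $v_j=e_{Q'_j}v_je_{P'_j}$ of $\ker\varepsilon$, which freely generate $\ker\varepsilon$ as a $\Gamma$-$\Gamma$-bimodule: $\ker\varepsilon\cong\bigoplus_j\Gamma e_{Q'_j}\otimes_k e_{P'_j}\Gamma$. Put $\delta(\gamma)=\gamma\,\omega(1)-\omega(1)\,\gamma$ for $\gamma\in\Gamma$. It is required that each $\delta(a_i)$ lie in the sub-bimodule generated by $v_1,\dots,v_m$ over the subalgebra of $\Gamma$ generated by the image of $\Gamma'$ and $a_1,\dots,a_{i-1}$.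 **Wildness.** Let $T$ be a $\Gamma$-$k\langle x,y\rangle$-bimodule, on which $k$ acts centrally, that is free of rank $r$ as a right $k\langle x,y\rangle$-module. Composing $T\otimes_{k\langle x,y\rangle}-$ with the canonical functor from finite-dimensional $\Gamma$-modules to $R(\mathfrak A)$ gives a functor $F_T$ from finite-dimensional $k\langle x,y\rangle$-modules to $R(\mathfrak A)$. The bocs $\mathfrak A$ is *wild* if, for some such $T$ of some finite rank, $F_T$ preserves iso-classes ($F_T(M)\cong F_T(N)$ implies $M\cong N$) and indecomposability ($M$ indecomposable implies $F_T(M)$ indecomposable). **Theorem 5.1.1.** Let $\mathfrak A$ be a bocs with a layer $L=(\Gamma';\omega;a_1,\dots,a_n;v_1,\dots,v_m)$, $n\ge1$, and let $a_1:P\to Q$ (where $P=Q$ is allowed). Then $\mathfrak A$ is wild in each of the following cases. *Case 1.* $\Gamma'(P,P)=k[\lambda,g_P(\lambda)^{-1}]$, $\Gamma'(Q,Q)=k[\mu,g_Q(\mu)^{-1}]$, $m\ge1$, and $\delta(a_1)=f(\lambda,\mu)v_1$, where $f(\lambda,\mu)\in\Gamma'(P,P)\otimes_k\Gamma'(Q,Q)=k[\lambda,\mu,g_P(\lambda)^{-1},g_Q(\mu)^{-1}]$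 is not invertible. Here $\lambda^i\mu^jv_1=\mu^j\,v_1\,\lambda^i$, so $\lambda$ acts at the source and $\mu$ at the target. *Case 2.* $\Gamma'(P,P)=k[\lambda,g_P(\lambda)^{-1}]$, $\Gamma'(Q,Q)=k$ and $\delta(a_1)=0$; or dually $\Gamma'(P,P)=k$, $\Gamma'(Q,Q)=k[\mu,g_Q(\mu)^{-1}]$ and $\delta(a_1)=0$. Moreover, in each case wildness is realized by a bimodule $T$ of rank at most $20$, so that $F_T$ sends a module of dimension $d$ to a representation of dimension at most $20\,d$. -/

import Mathlib

open CategoryTheory CategoryTheory.Limits TensorProduct MulOpposite Polynomial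
open scoped Matrix.Module

universe u

set_option linter.unusedSectionVars false

namespace LayeredBocs

/-! ### Finite-dimensional modules over a `k`-algebra -/

section FDMod

/-- A finite-dimensional left module over the `k`-algebra `A`. -/
structure FDMod (k : Type u) (A : Type u) [Field k] [Ring A] [Algebra k A] where
  carrier : Type u
  [addCommGroup : AddCommGroup carrier]
  [moduleBase : Module k carrier]
  [module : Module A carrier]
  [isScalarTower : IsScalarTower k A carrier]
  [finiteDimensional : FiniteDimensional k carrier]

attribute [instance] FDMod.addCommGroup FDMod.moduleBase FDMod.module FDMod.isScalarTower
  FDMod.finiteDimensional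

variable {k : Type u} {A : Type u} [Field k] [Ring A] [Algebra k A]

/-- The category of finite-dimensional left `A`-modules; morphisms are `A`-linear maps. -/
instance FDMod.category : Category (FDMod k A) where
  Hom M N := M.carrier →ₗ[A] N.carrier
  id _ := LinearMap.id
  comp f g := g.comp f

instance FDMod.preadditive : Preadditive (FDMod k A) where
  homGroup M N := inferInstanceAs (AddCommGroup (M.carrier →ₗ[A] N.carrier))
  add_comp _ _ _ f f' g := LinearMap.comp_add f f' g
  comp_add _ _ _ f g g' := LinearMap.add_comp f g' g

/-- The direct sum of two modules. -/
def FDMod.prod (M N : FDMod k A) : FDMod k A where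
  carrier := M.carrier × N.carrier

/-- The direct sum of two modules, with its injections and projections. -/
def FDMod.prodBicone (M N : FDMod k A) : BinaryBicone M N where
  pt := FDMod.prod M N
  fst := LinearMap.fst A M.carrier N.carrier
  snd := LinearMap.snd A M.carrier N.carrier
  inl := LinearMap.inl A M.carrier N.carrier
  inr := LinearMap.inr A M.carrier N.carrier
  inl_fst := LinearMap.fst_comp_inl A M.carrier N.carrier
  inl_snd := LinearMap.snd_comp_inl A M.carrier N.carrier
  inr_fst := LinearMap.fst_comp_inr A M.carrier N.carrier
  inr_snd := LinearMap.snd_comp_inr A M.carrier N.carrier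

lemma FDMod.prodBicone_total (M N : FDMod k A) :
    (FDMod.prodBicone M N).fst ≫ (FDMod.prodBicone M N).inl +
      (FDMod.prodBicone M N).snd ≫ (FDMod.prodBicone M N).inr = 𝟙 (FDMod.prodBicone M N).pt :=
  LinearMap.ext fun x : M.carrier × N.carrier =>
    show ((x.1, 0) : M.carrier × N.carrier) + (0, x.2) = x from
      Prod.ext (add_zero x.1) (zero_add x.2)

instance FDMod.hasBinaryBiproducts : HasBinaryBiproducts (FDMod k A) where
  has_binary_biproduct M N := HasBinaryBiproduct.mk
    { bicone := FDMod.prodBicone M N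
      isBilimit := isBinaryBilimitOfTotal _ (FDMod.prodBicone_total M N) }

end FDMod

/-! ### Tensor powers of a bimodule over a noncommutative algebra -/

section Balanced

variable (k Γ Ω : Type u) [Field k] [Ring Γ] [Algebra k Γ] [AddCommGroup Ω] [Module k Ω]
  [Module Γ Ω] [Module Γᵐᵒᵖ Ω] [SMulCommClass Γ Γᵐᵒᵖ Ω] [IsScalarTower k Γ Ω]
  [IsScalarTower k Γᵐᵒᵖ Ω]

/-- The relations `xγ ⊗ y = x ⊗ γy` in `Ω ⊗ₖ Ω`. -/
def balRel₂ : Submodule k (Ω ⊗[k] Ω) :=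
  Submodule.span k {z | ∃ (x y : Ω) (γ : Γ), z = (op γ • x) ⊗ₜ[k] y - x ⊗ₜ[k] (γ • y)}

/-- `Ω ⊗_Γ Ω`. -/
abbrev BalTensor₂ : Type u := (Ω ⊗[k] Ω) ⧸ balRel₂ k Γ Ω

/-- The relations `xγ ⊗ y ⊗ z = x ⊗ γy ⊗ z` and `x ⊗ yγ ⊗ z = x ⊗ y ⊗ γz`. -/
def balRel₃ : Submodule k (Ω ⊗[k] (Ω ⊗[k] Ω)) :=
  Submodule.span k
    ({t | ∃ (x y z : Ω) (γ : Γ),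
        t = (op γ • x) ⊗ₜ[k] (y ⊗ₜ[k] z) - x ⊗ₜ[k] ((γ • y) ⊗ₜ[k] z)} ∪
     {t | ∃ (x y z : Ω) (γ : Γ),
        t = x ⊗ₜ[k] ((op γ • y) ⊗ₜ[k] z) - x ⊗ₜ[k] (y ⊗ₜ[k] (γ • z))})

/-- `Ω ⊗_Γ Ω ⊗_Γ Ω`. -/
abbrev BalTensor₃ : Type u := (Ω ⊗[k] (Ω ⊗[k] Ω)) ⧸ balRel₃ k Γ Ω

variable {k Γ Ω}

/-- The class of `x ⊗ y` in `Ω ⊗_Γ Ω`. -/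
def bal₂ (x y : Ω) : BalTensor₂ k Γ Ω := (balRel₂ k Γ Ω).mkQ (x ⊗ₜ[k] y)

/-- The class of `x ⊗ y ⊗ z` in `Ω ⊗_Γ Ω ⊗_Γ Ω`. -/
def bal₃ (x y z : Ω) : BalTensor₃ k Γ Ω := (balRel₃ k Γ Ω).mkQ (x ⊗ₜ[k] (y ⊗ₜ[k] z))

lemma bal₂_smul (x y : Ω) (γ : Γ) :
    bal₂ (k := k) (Γ := Γ) (op γ • x) y = bal₂ x (γ • y) := by
  refine (Submodule.Quotient.eq _).2 (Submodule.subset_span ⟨x, y, γ, rfl⟩)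

lemma bal₃_smul_left (x y z : Ω) (γ : Γ) :
    bal₃ (k := k) (Γ := Γ) (op γ • x) y z = bal₃ x (γ • y) z := by
  refine (Submodule.Quotient.eq _).2 (Submodule.subset_span (Or.inl ⟨x, y, z, γ, rfl⟩))

lemma bal₃_smul_right (x y z : Ω) (γ : Γ) :
    bal₃ (k := k) (Γ := Γ) x (op γ • y) z = bal₃ x y (γ • z) := by
  refine (Submodule.Quotient.eq _).2 (Submodule.subset_span (Or.inr ⟨x, y, z, γ, rfl⟩))

lemma bal₃_add_left (x x' y z : Ω) :
    bal₃ (k := k) (Γ := Γ) (x + x') y z = bal₃ x y z + bal₃ x' y z := by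
  rw [bal₃, TensorProduct.add_tmul, map_add]; rfl

lemma bal₃_add_mid (x y y' z : Ω) :
    bal₃ (k := k) (Γ := Γ) x (y + y') z = bal₃ x y z + bal₃ x y' z := by
  rw [bal₃, TensorProduct.add_tmul, TensorProduct.tmul_add, map_add]; rfl

lemma bal₃_add_right (x y z z' : Ω) :
    bal₃ (k := k) (Γ := Γ) x y (z + z') = bal₃ x y z + bal₃ x y z' := by
  rw [bal₃, TensorProduct.tmul_add, TensorProduct.tmul_add, map_add]; rfl

lemma bal₃_base_smul_left (c : k) (x y z : Ω) :
    bal₃ (k := k) (Γ := Γ) (c • x) y z = c • bal₃ x y z := by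
  rw [bal₃, ← TensorProduct.smul_tmul', map_smul]; rfl

lemma bal₃_base_smul_mid (c : k) (x y z : Ω) :
    bal₃ (k := k) (Γ := Γ) x (c • y) z = c • bal₃ x y z := by
  rw [bal₃, ← TensorProduct.smul_tmul', TensorProduct.tmul_smul, map_smul]; rfl

lemma bal₃_base_smul_right (c : k) (x y z : Ω) :
    bal₃ (k := k) (Γ := Γ) x y (c • z) = c • bal₃ x y z := by
  rw [bal₃, TensorProduct.tmul_smul, TensorProduct.tmul_smul, map_smul]; rfl

lemma balRel₂_le_ker {W : Type*} [AddCommGroup W] [Module k W] (f : Ω →ₗ[k] Ω →ₗ[k] W)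
    (hf : ∀ (x y : Ω) (γ : Γ), f (op γ • x) y = f x (γ • y)) :
    balRel₂ k Γ Ω ≤ LinearMap.ker (TensorProduct.lift f) := by
  refine Submodule.span_le.2 ?_
  rintro _ ⟨x, y, γ, rfl⟩
  simp [hf x y γ]

/-- A `k`-bilinear map on `Ω` that is `Γ`-balanced induces a linear map on `Ω ⊗_Γ Ω`. -/
def BalTensor₂.lift {W : Type*} [AddCommGroup W] [Module k W] (f : Ω →ₗ[k] Ω →ₗ[k] W)
    (hf : ∀ (x y : Ω) (γ : Γ), f (op γ • x) y = f x (γ • y)) : BalTensor₂ k Γ Ω →ₗ[k] W :=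
  (balRel₂ k Γ Ω).liftQ (TensorProduct.lift f) (balRel₂_le_ker f hf)

@[simp] lemma BalTensor₂.lift_bal₂ {W : Type*} [AddCommGroup W] [Module k W]
    (f : Ω →ₗ[k] Ω →ₗ[k] W) (hf : ∀ (x y : Ω) (γ : Γ), f (op γ • x) y = f x (γ • y)) (x y : Ω) :
    BalTensor₂.lift f hf (bal₂ x y) = f x y :=
  TensorProduct.lift.tmul x y

lemma BalTensor₂.hom_ext {W : Type*} [AddCommGroup W] [Module k W]
    {f g : BalTensor₂ k Γ Ω →ₗ[k] W} (h : ∀ x y, f (bal₂ x y) = g (bal₂ x y)) : f = g := by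
  refine Submodule.linearMap_qext _ (TensorProduct.ext' fun x y => ?_)
  exact h x y

/-- The bilinear map `(x, y) ↦ x ⊗ y` into `Ω ⊗_Γ Ω`. -/
def mkBal₂ : Ω →ₗ[k] Ω →ₗ[k] BalTensor₂ k Γ Ω :=
  (TensorProduct.mk k Ω Ω).compr₂ (balRel₂ k Γ Ω).mkQ

/-- The left action of `γ` on `Ω ⊗_Γ Ω`: `x ⊗ y ↦ γx ⊗ y`. -/
def BalTensor₂.lmul (γ : Γ) : BalTensor₂ k Γ Ω →ₗ[k] BalTensor₂ k Γ Ω :=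
  BalTensor₂.lift (mkBal₂.comp (DistribSMul.toLinearMap k Ω γ)) (fun x y c => by
    change bal₂ (γ • op c • x) y = bal₂ (γ • x) (c • y)
    rw [smul_comm, bal₂_smul])

/-- The right action of `γ` on `Ω ⊗_Γ Ω`: `x ⊗ y ↦ x ⊗ yγ`. -/
def BalTensor₂.rmul (γ : Γ) : BalTensor₂ k Γ Ω →ₗ[k] BalTensor₂ k Γ Ω :=
  BalTensor₂.lift (mkBal₂.compl₂ (DistribSMul.toLinearMap k Ω (op γ))) (fun x y c => by
    change bal₂ (op c • x) (op γ • y) = bal₂ x (op γ • c • y)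
    rw [bal₂_smul, smul_comm])

/-- `x ↦ (y ⊗ z ↦ x ⊗ y ⊗ z)`. -/
def consLeft (x : Ω) : BalTensor₂ k Γ Ω →ₗ[k] BalTensor₃ k Γ Ω :=
  BalTensor₂.lift
    (LinearMap.mk₂ k (fun y z => bal₃ x y z)
      (fun y y' z => bal₃_add_mid x y y' z)
      (fun c y z => bal₃_base_smul_mid c x y z)
      (fun y z z' => bal₃_add_right x y z z')
      (fun c y z => bal₃_base_smul_right c x y z))
    (fun y z γ => bal₃_smul_right x y z γ)

/-- `z ↦ (x ⊗ y ↦ x ⊗ y ⊗ z)`. -/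
def consRight (z : Ω) : BalTensor₂ k Γ Ω →ₗ[k] BalTensor₃ k Γ Ω :=
  BalTensor₂.lift
    (LinearMap.mk₂ k (fun x y => bal₃ x y z)
      (fun x x' y => bal₃_add_left x x' y z)
      (fun c x y => bal₃_base_smul_left c x y z)
      (fun x y y' => bal₃_add_mid x y y' z)
      (fun c x y => bal₃_base_smul_mid c x y z))
    (fun x y γ => bal₃_smul_left x y z γ)

@[simp] lemma consLeft_bal₂ (x y z : Ω) :
    consLeft (k := k) (Γ := Γ) x (bal₂ y z) = bal₃ x y z :=
  BalTensor₂.lift_bal₂ _ _ y z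

@[simp] lemma consRight_bal₂ (x y z : Ω) :
    consRight (k := k) (Γ := Γ) z (bal₂ x y) = bal₃ x y z :=
  BalTensor₂.lift_bal₂ _ _ x y

lemma consLeft_add (x x' : Ω) :
    consLeft (k := k) (Γ := Γ) (x + x') = consLeft x + consLeft x' :=
  BalTensor₂.hom_ext fun y z => by simp [bal₃_add_left]

lemma consLeft_smul (c : k) (x : Ω) :
    consLeft (k := k) (Γ := Γ) (c • x) = c • consLeft x :=
  BalTensor₂.hom_ext fun y z => by simp [bal₃_base_smul_left]

lemma consRight_add (x x' : Ω) :
    consRight (k := k) (Γ := Γ) (x + x') = consRight x + consRight x' :=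
  BalTensor₂.hom_ext fun y z => by simp [bal₃_add_right]

lemma consRight_smul (c : k) (x : Ω) :
    consRight (k := k) (Γ := Γ) (c • x) = c • consRight x :=
  BalTensor₂.hom_ext fun y z => by simp [bal₃_base_smul_right]

lemma consLeft_op_smul (x : Ω) (γ : Γ) (t : BalTensor₂ k Γ Ω) :
    consLeft (op γ • x) t = consLeft x (BalTensor₂.lmul γ t) := by
  suffices h : consLeft (k := k) (op γ • x) = (consLeft x).comp (BalTensor₂.lmul γ) from
    LinearMap.congr_fun h t
  refine BalTensor₂.hom_ext fun y z => ?_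
  have : BalTensor₂.lmul (k := k) γ (bal₂ y z) = bal₂ (γ • y) z := by
    simp only [BalTensor₂.lmul, BalTensor₂.lift_bal₂]; rfl
  simp [this, bal₃_smul_left]

lemma consRight_smul' (z : Ω) (γ : Γ) (t : BalTensor₂ k Γ Ω) :
    consRight (γ • z) t = consRight z (BalTensor₂.rmul γ t) := by
  suffices h : consRight (k := k) (γ • z) = (consRight z).comp (BalTensor₂.rmul γ) from
    LinearMap.congr_fun h t
  refine BalTensor₂.hom_ext fun x y => ?_
  have : BalTensor₂.rmul (k := k) γ (bal₂ x y) = bal₂ x (op γ • y) := by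
    simp only [BalTensor₂.rmul, BalTensor₂.lift_bal₂]; rfl
  simp [this, bal₃_smul_right]

/-- `id ⊗ m : Ω ⊗_Γ Ω → Ω ⊗_Γ (Ω ⊗_Γ Ω)` for a left `Γ`-linear `m : Ω → Ω ⊗_Γ Ω`. -/
def idTensor (m : Ω →ₗ[k] BalTensor₂ k Γ Ω)
    (hm : ∀ (γ : Γ) (x : Ω), m (γ • x) = BalTensor₂.lmul γ (m x)) :
    BalTensor₂ k Γ Ω →ₗ[k] BalTensor₃ k Γ Ω :=
  BalTensor₂.lift
    (LinearMap.mk₂ k (fun x y => consLeft x (m y))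
      (fun _ _ _ => by rw [consLeft_add, LinearMap.add_apply])
      (fun _ _ _ => by rw [consLeft_smul, LinearMap.smul_apply])
      (fun _ _ _ => by rw [map_add, map_add])
      (fun _ _ _ => by rw [map_smul, map_smul]))
    (fun x y γ => by
      change consLeft (op γ • x) (m y) = consLeft x (m (γ • y))
      rw [hm, consLeft_op_smul])

/-- `m ⊗ id : Ω ⊗_Γ Ω → (Ω ⊗_Γ Ω) ⊗_Γ Ω` for a right `Γ`-linear `m : Ω → Ω ⊗_Γ Ω`. -/
def tensorId (m : Ω →ₗ[k] BalTensor₂ k Γ Ω)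
    (hm : ∀ (γ : Γ) (x : Ω), m (op γ • x) = BalTensor₂.rmul γ (m x)) :
    BalTensor₂ k Γ Ω →ₗ[k] BalTensor₃ k Γ Ω :=
  BalTensor₂.lift
    (LinearMap.mk₂ k (fun x y => consRight y (m x))
      (fun _ _ _ => by rw [map_add, map_add])
      (fun _ _ _ => by rw [map_smul, map_smul])
      (fun _ _ _ => by rw [consRight_add, LinearMap.add_apply])
      (fun _ _ _ => by rw [consRight_smul, LinearMap.smul_apply]))
    (fun x y γ => by
      change consRight y (m (op γ • x)) = consRight (γ • y) (m x)
      rw [hm, consRight_smul'])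

end Balanced

/-! ### Bocses -/

/-- A bocs `(Γ, Ω)` over `k`: a coalgebra structure (comultiplication `comul` and counit `counit`,
both maps of `Γ`-`Γ`-bimodules) on the `Γ`-`Γ`-bimodule `Ω`, on which `k` acts centrally. The right
action of `γ` is written `op γ • x`. -/
structure Bocs (k Γ Ω : Type u) [Field k] [Ring Γ] [Algebra k Γ] [AddCommGroup Ω] [Module k Ω]
    [Module Γ Ω] [Module Γᵐᵒᵖ Ω] [SMulCommClass Γ Γᵐᵒᵖ Ω] [IsScalarTower k Γ Ω]
    [IsScalarTower k Γᵐᵒᵖ Ω] where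
  comul : Ω →ₗ[k] BalTensor₂ k Γ Ω
  comul_smul : ∀ (γ : Γ) (x : Ω), comul (γ • x) = BalTensor₂.lmul γ (comul x)
  comul_op_smul : ∀ (γ : Γ) (x : Ω), comul (op γ • x) = BalTensor₂.rmul γ (comul x)
  counit : Ω →ₗ[k] Γ
  counit_smul : ∀ (γ : Γ) (x : Ω), counit (γ • x) = γ * counit x
  counit_op_smul : ∀ (γ : Γ) (x : Ω), counit (op γ • x) = counit x * γ
  coassoc : ∀ x : Ω, tensorId comul comul_op_smul (comul x) = idTensor comul comul_smul (comul x)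
  counit_left : ∀ x : Ω,
    BalTensor₂.lift
      (LinearMap.mk₂ k (fun x y : Ω => counit x • y)
        (fun _ _ _ => by rw [map_add, add_smul])
        (fun _ _ _ => by rw [map_smul, smul_assoc])
        (fun _ _ _ => smul_add _ _ _)
        (fun _ _ _ => smul_comm _ _ _))
      (fun x y γ => by
        change counit (op γ • x) • y = counit x • γ • y
        rw [counit_op_smul, mul_smul]) (comul x) = x
  counit_right : ∀ x : Ω,
    BalTensor₂.lift
      (LinearMap.mk₂ k (fun x y : Ω => op (counit y) • x)
        (fun _ _ _ => smul_add _ _ _)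
        (fun _ _ _ => smul_comm _ _ _)
        (fun _ _ _ => by rw [map_add, MulOpposite.op_add, add_smul])
        (fun _ _ _ => by rw [map_smul, MulOpposite.op_smul, smul_assoc]))
      (fun x y γ => by
        change op (counit y) • op γ • x = op (counit (γ • y)) • x
        rw [counit_smul, MulOpposite.op_mul, mul_smul]) (comul x) = x

section Rep

variable {k Γ Ω : Type u} [Field k] [Ring Γ] [Algebra k Γ] [AddCommGroup Ω] [Module k Ω]
  [Module Γ Ω] [Module Γᵐᵒᵖ Ω] [SMulCommClass Γ Γᵐᵒᵖ Ω] [IsScalarTower k Γ Ω]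
  [IsScalarTower k Γᵐᵒᵖ Ω]

/-- The `Γ`-`Γ`-bimodule maps `Ω → Hom_k(M, N)`, equivalently the `Γ`-linear maps
`Ω ⊗_Γ M → N`. -/
def bimodHom (Ω : Type u) [AddCommGroup Ω] [Module k Ω] [Module Γ Ω] [Module Γᵐᵒᵖ Ω]
    (M N : FDMod k Γ) : Submodule k (Ω →ₗ[k] M.carrier →ₗ[k] N.carrier) where
  carrier := {φ | (∀ (γ : Γ) (x : Ω) (m : M.carrier), φ (γ • x) m = γ • φ x m) ∧
    ∀ (γ : Γ) (x : Ω) (m : M.carrier), φ (op γ • x) m = φ x (γ • m)}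
  add_mem' := by
    rintro φ ψ ⟨h1, h2⟩ ⟨h3, h4⟩
    exact ⟨fun γ x m => by simp [h1, h3], fun γ x m => by simp [h2, h4]⟩
  zero_mem' := ⟨fun γ x m => by simp, fun γ x m => by simp⟩
  smul_mem' := by
    rintro c φ ⟨h1, h2⟩
    exact ⟨fun γ x m => by
        rw [LinearMap.smul_apply, LinearMap.smul_apply, h1, LinearMap.smul_apply,
          LinearMap.smul_apply, smul_comm],
      fun γ x m => by simp [h2]⟩

/-- Evaluation of a pair of bimodule maps on `Ω ⊗_Γ Ω`: `x ⊗ y ↦ ψ(x) ∘ φ(y)`. -/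
def pairing {M N E : FDMod k Γ} (φ : bimodHom Ω M N) (ψ : bimodHom Ω N E) :
    BalTensor₂ k Γ Ω →ₗ[k] M.carrier →ₗ[k] E.carrier :=
  BalTensor₂.lift
    (LinearMap.mk₂ k (fun x y => (ψ.1 x).comp (φ.1 y))
      (fun _ _ _ => by rw [map_add, LinearMap.add_comp])
      (fun _ _ _ => by rw [map_smul, LinearMap.smul_comp])
      (fun _ _ _ => by rw [map_add, LinearMap.comp_add])
      (fun _ _ _ => by rw [map_smul, LinearMap.comp_smul]))
    (fun x y γ => by
      refine LinearMap.ext fun m => ?_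
      change ψ.1 (op γ • x) (φ.1 y m) = ψ.1 x (φ.1 (γ • y) m)
      rw [ψ.2.2, φ.2.1])

@[simp] lemma pairing_bal₂ {M N E : FDMod k Γ} (φ : bimodHom Ω M N) (ψ : bimodHom Ω N E)
    (x y : Ω) : pairing φ ψ (bal₂ x y) = (ψ.1 x).comp (φ.1 y) := by
  rw [pairing, BalTensor₂.lift_bal₂, LinearMap.mk₂_apply]

lemma pairing_lmul {M N E : FDMod k Γ} (φ : bimodHom Ω M N) (ψ : bimodHom Ω N E)
    (γ : Γ) (t : BalTensor₂ k Γ Ω) (m : M.carrier) :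
    pairing φ ψ (BalTensor₂.lmul γ t) m = γ • pairing φ ψ t m := by
  obtain ⟨t, rfl⟩ := Submodule.mkQ_surjective _ t
  induction t with
  | zero => simp
  | add s t hs ht => simp only [map_add, LinearMap.add_apply, hs, ht, smul_add]
  | tmul x y =>
    change pairing φ ψ (BalTensor₂.lmul γ (bal₂ x y)) m = γ • pairing φ ψ (bal₂ x y) m
    have : BalTensor₂.lmul (k := k) γ (bal₂ x y) = bal₂ (γ • x) y := by
      simp only [BalTensor₂.lmul, BalTensor₂.lift_bal₂]; rfl
    rw [this, pairing_bal₂, pairing_bal₂]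
    exact ψ.2.1 γ x _

lemma pairing_rmul {M N E : FDMod k Γ} (φ : bimodHom Ω M N) (ψ : bimodHom Ω N E)
    (γ : Γ) (t : BalTensor₂ k Γ Ω) (m : M.carrier) :
    pairing φ ψ (BalTensor₂.rmul γ t) m = pairing φ ψ t (γ • m) := by
  obtain ⟨t, rfl⟩ := Submodule.mkQ_surjective _ t
  induction t with
  | zero => simp
  | add s t hs ht => simp only [map_add, LinearMap.add_apply, hs, ht]
  | tmul x y =>
    change pairing φ ψ (BalTensor₂.rmul γ (bal₂ x y)) m = pairing φ ψ (bal₂ x y) (γ • m)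
    have : BalTensor₂.rmul (k := k) γ (bal₂ x y) = bal₂ x (op γ • y) := by
      simp only [BalTensor₂.rmul, BalTensor₂.lift_bal₂]; rfl
    rw [this, pairing_bal₂, pairing_bal₂]
    exact congrArg (ψ.1 x) (φ.2.2 γ y m)

namespace Bocs

variable (A : Bocs k Γ Ω)

/-- Composition in the representation category: `x ↦ Σ ψ(x₁) ∘ φ(x₂)` for
`comul x = Σ x₁ ⊗ x₂`. -/
def compHom {M N E : FDMod k Γ} (φ : bimodHom Ω M N) (ψ : bimodHom Ω N E) : bimodHom Ω M E :=
  ⟨(pairing φ ψ).comp A.comul,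
    fun γ x m => by
      rw [LinearMap.comp_apply, A.comul_smul, pairing_lmul]; rfl,
    fun γ x m => by
      rw [LinearMap.comp_apply, A.comul_op_smul, pairing_rmul]; rfl⟩

/-- The morphism of representations induced by a `Γ`-linear map `θ`: `x ↦ (m ↦ ε(x) θ(m))`. -/
def ofLinear {M N : FDMod k Γ} (θ : M.carrier →ₗ[Γ] N.carrier) : bimodHom Ω M N :=
  ⟨LinearMap.mk₂ k (fun x m => A.counit x • θ m)
      (fun _ _ _ => by rw [map_add, add_smul])
      (fun _ _ _ => by rw [map_smul, smul_assoc])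
      (fun _ _ _ => by rw [map_add, smul_add])
      (fun c x m => by
        rw [← algebraMap_smul Γ c m, map_smul, algebraMap_smul, smul_comm]),
    fun γ x m => by
      change A.counit (γ • x) • θ m = γ • A.counit x • θ m
      rw [A.counit_smul, mul_smul],
    fun γ x m => by
      change A.counit (op γ • x) • θ m = A.counit x • θ (γ • m)
      rw [A.counit_op_smul, mul_smul, map_smul]⟩

@[simp] lemma ofLinear_apply {M N : FDMod k Γ} (θ : M.carrier →ₗ[Γ] N.carrier) (x : Ω)
    (m : M.carrier) : (A.ofLinear θ).1 x m = A.counit x • θ m := rfl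

lemma compHom_ofLinear_left {M N E : FDMod k Γ} (θ : M.carrier →ₗ[Γ] N.carrier)
    (ψ : bimodHom Ω N E) (x : Ω) (m : M.carrier) :
    (A.compHom (A.ofLinear θ) ψ).1 x m = ψ.1 x (θ m) := by
  conv_rhs => rw [← A.counit_right x]
  change pairing (A.ofLinear θ) ψ (A.comul x) m = _
  generalize A.comul x = t
  obtain ⟨t, rfl⟩ := Submodule.mkQ_surjective _ t
  induction t with
  | zero => simp
  | add s t hs ht => simp only [map_add, LinearMap.add_apply, hs, ht]
  | tmul y z =>
    change pairing (A.ofLinear θ) ψ (bal₂ y z) m =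
      ψ.1 (BalTensor₂.lift _ _ (bal₂ y z)) (θ m)
    rw [pairing_bal₂, BalTensor₂.lift_bal₂]
    change ψ.1 y (A.counit z • θ m) = ψ.1 (op (A.counit z) • y) (θ m)
    rw [ψ.2.2]

lemma compHom_ofLinear_right {M N E : FDMod k Γ} (φ : bimodHom Ω M N)
    (θ : N.carrier →ₗ[Γ] E.carrier) (x : Ω) (m : M.carrier) :
    (A.compHom φ (A.ofLinear θ)).1 x m = θ (φ.1 x m) := by
  conv_rhs => rw [← A.counit_left x]
  change pairing φ (A.ofLinear θ) (A.comul x) m = _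
  generalize A.comul x = t
  obtain ⟨t, rfl⟩ := Submodule.mkQ_surjective _ t
  induction t with
  | zero => simp
  | add s t hs ht => simp only [map_add, LinearMap.add_apply, hs, ht]
  | tmul y z =>
    change pairing φ (A.ofLinear θ) (bal₂ y z) m =
      θ (φ.1 (BalTensor₂.lift _ _ (bal₂ y z)) m)
    rw [pairing_bal₂, BalTensor₂.lift_bal₂]
    change A.counit y • θ (φ.1 z m) = θ (φ.1 (A.counit y • z) m)
    rw [φ.2.1, map_smul]

lemma compHom_assoc {M N E G : FDMod k Γ} (φ : bimodHom Ω M N) (ψ : bimodHom Ω N E)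
    (χ : bimodHom Ω E G) :
    A.compHom (A.compHom φ ψ) χ = A.compHom φ (A.compHom ψ χ) := by
  let T : BalTensor₃ k Γ Ω →ₗ[k] M.carrier →ₗ[k] G.carrier :=
    (balRel₃ k Γ Ω).liftQ
      (TensorProduct.lift
        { toFun := fun x => (LinearMap.llcomp k M.carrier E.carrier G.carrier (χ.1 x)).comp
            (TensorProduct.lift (LinearMap.mk₂ k (fun y z => (ψ.1 y).comp (φ.1 z))
              (fun _ _ _ => by rw [map_add, LinearMap.add_comp])
              (fun _ _ _ => by rw [map_smul, LinearMap.smul_comp])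
              (fun _ _ _ => by rw [map_add, LinearMap.comp_add])
              (fun _ _ _ => by rw [map_smul, LinearMap.comp_smul])))
          map_add' := fun x x' => by simp [LinearMap.add_comp]
          map_smul' := fun c x => by simp [LinearMap.smul_comp] }) (by
      refine Submodule.span_le.2 ?_
      rintro _ (⟨x, y, z, γ, rfl⟩ | ⟨x, y, z, γ, rfl⟩)
      · refine LinearMap.mem_ker.2 (LinearMap.ext fun m => ?_)
        simp [χ.2.2, ψ.2.1]
      · refine LinearMap.mem_ker.2 (LinearMap.ext fun m => ?_)
        simp [ψ.2.2, φ.2.1])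
  have hT : ∀ x y z, T (bal₃ x y z) = (χ.1 x).comp ((ψ.1 y).comp (φ.1 z)) := fun x y z => by
    rfl
  have hL : ∀ (x : Ω) (t : BalTensor₂ k Γ Ω),
      T (consLeft x t) = (χ.1 x).comp (pairing φ ψ t) := fun x t => by
    suffices h : T.comp (consLeft x) =
        (LinearMap.llcomp k M.carrier E.carrier G.carrier (χ.1 x)).comp (pairing φ ψ) from
      LinearMap.congr_fun h t
    refine BalTensor₂.hom_ext fun y z => ?_
    simp only [LinearMap.comp_apply, consLeft_bal₂, hT, pairing_bal₂]
    rfl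
  have hR : ∀ (z : Ω) (t : BalTensor₂ k Γ Ω),
      T (consRight z t) = (pairing ψ χ t).comp (φ.1 z) := fun z t => by
    suffices h : T.comp (consRight z) =
        ((LinearMap.llcomp k M.carrier N.carrier G.carrier).flip (φ.1 z)).comp
          (pairing ψ χ) from
      LinearMap.congr_fun h t
    refine BalTensor₂.hom_ext fun x y => ?_
    simp only [LinearMap.comp_apply, consRight_bal₂, hT, pairing_bal₂]
    rfl
  have h1 : pairing (A.compHom φ ψ) χ = T.comp (idTensor A.comul A.comul_smul) := by
    refine BalTensor₂.hom_ext fun x y => ?_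
    simp only [LinearMap.comp_apply, pairing_bal₂, idTensor, BalTensor₂.lift_bal₂,
      LinearMap.mk₂_apply, hL]
    rfl
  have h2 : pairing φ (A.compHom ψ χ) = T.comp (tensorId A.comul A.comul_op_smul) := by
    refine BalTensor₂.hom_ext fun x y => ?_
    simp only [LinearMap.comp_apply, pairing_bal₂, tensorId, BalTensor₂.lift_bal₂,
      LinearMap.mk₂_apply, hR]
    rfl
  refine Subtype.ext (LinearMap.ext fun x => ?_)
  change pairing (A.compHom φ ψ) χ (A.comul x) = pairing φ (A.compHom ψ χ) (A.comul x)
  rw [h1, h2, LinearMap.comp_apply, LinearMap.comp_apply, A.coassoc]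

/-- A representation of the bocs `A = (Γ, Ω)`: a finite-dimensional left `Γ`-module. -/
structure Rep (A : Bocs k Γ Ω) where
  obj : FDMod k Γ

/-- The representation category `R(A)`. A morphism `M ⟶ N` is a `Γ`-`Γ`-bimodule map
`Ω → Hom_k(M, N)`; composition uses the comultiplication, the identity is given by the counit. -/
instance Rep.category : Category (Rep A) where
  Hom M N := bimodHom Ω M.obj N.obj
  id _ := A.ofLinear LinearMap.id
  comp φ ψ := A.compHom φ ψ
  id_comp φ := Subtype.ext (LinearMap.ext₂ fun x m => A.compHom_ofLinear_left LinearMap.id φ x m)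
  comp_id φ := Subtype.ext (LinearMap.ext₂ fun x m => A.compHom_ofLinear_right φ LinearMap.id x m)
  assoc φ ψ χ := A.compHom_assoc φ ψ χ

lemma pairing_add_left {M N E : FDMod k Γ} (φ φ' : bimodHom Ω M N) (ψ : bimodHom Ω N E) :
    pairing (φ + φ') ψ = pairing φ ψ + pairing φ' ψ :=
  BalTensor₂.hom_ext fun x y => by
    rw [LinearMap.add_apply, pairing_bal₂, pairing_bal₂, pairing_bal₂, Submodule.coe_add,
      LinearMap.add_apply, LinearMap.comp_add]

lemma pairing_add_right {M N E : FDMod k Γ} (φ : bimodHom Ω M N) (ψ ψ' : bimodHom Ω N E) :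
    pairing φ (ψ + ψ') = pairing φ ψ + pairing φ ψ' :=
  BalTensor₂.hom_ext fun x y => by
    rw [LinearMap.add_apply, pairing_bal₂, pairing_bal₂, pairing_bal₂, Submodule.coe_add,
      LinearMap.add_apply, LinearMap.add_comp]

instance Rep.preadditive : Preadditive (Rep A) where
  homGroup M N := inferInstanceAs (AddCommGroup (bimodHom Ω M.obj N.obj))
  add_comp _ _ _ φ φ' ψ := Subtype.ext (LinearMap.ext fun x =>
    LinearMap.congr_fun (pairing_add_left φ φ' ψ) (A.comul x))
  comp_add _ _ _ φ ψ ψ' := Subtype.ext (LinearMap.ext fun x =>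
    LinearMap.congr_fun (pairing_add_right φ ψ ψ') (A.comul x))

/-- The canonical functor from finite-dimensional `Γ`-modules to `R(A)`: the identity on objects,
and `θ ↦ (x ↦ ε(x) θ)` on morphisms. -/
def fromModules : FDMod k Γ ⥤ Rep A where
  obj M := ⟨M⟩
  map θ := A.ofLinear θ
  map_id _ := rfl
  map_comp θ η := Subtype.ext (LinearMap.ext₂ fun x m =>
    (A.compHom_ofLinear_left θ (A.ofLinear η) x m).symm)

instance fromModules_additive : A.fromModules.Additive where
  map_add {M N θ η} := Subtype.ext (LinearMap.ext₂ fun x m =>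
    smul_add (A.counit x) (DFunLike.coe (F := M.carrier →ₗ[Γ] N.carrier) θ m)
      (DFunLike.coe (F := M.carrier →ₗ[Γ] N.carrier) η m))

instance Rep.hasBinaryBiproducts : HasBinaryBiproducts (Rep A) where
  has_binary_biproduct M N :=
    HasBinaryBiproduct.mk
      { bicone := A.fromModules.mapBinaryBicone (FDMod.prodBicone M.obj N.obj)
        isBilimit := isBinaryBilimitOfTotal _ (by
          have h := congrArg A.fromModules.map (FDMod.prodBicone_total M.obj N.obj)
          rw [CategoryTheory.Functor.map_add, CategoryTheory.Functor.map_comp,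
            CategoryTheory.Functor.map_comp, CategoryTheory.Functor.map_id] at h
          exact h) }

end Bocs

/-! ### Wildness -/

/-- Let `T` be a `Γ`-`R`-bimodule that is free of rank `n` as a right `R`-module: `T = Rⁿ` (columns),
the left action of `Γ` being given by an algebra map `ρ : Γ → Mₙ(R)`. This is the left `Γ`-module
`T ⊗_R L = Lⁿ`, on which `γ` acts through the matrix `ρ γ`. -/
def tensorObj {R : Type u} [Ring R] [Algebra k R] {n : ℕ}
    (ρ : Γ →ₐ[k] Matrix (Fin n) (Fin n) R) (L : FDMod k R) : FDMod k Γ :=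
  letI : Module Γ (Fin n → L.carrier) := Module.compHom (Fin n → L.carrier) ρ.toRingHom
  haveI : IsScalarTower k Γ (Fin n → L.carrier) := ⟨fun c γ x => by
    change ρ (c • γ) • x = c • ρ γ • x
    rw [map_smul]
    funext i
    simp [Finset.smul_sum]⟩
  { carrier := Fin n → L.carrier }

/-- The map `T ⊗_R θ`, that is `θ` applied to each coordinate. -/
def tensorMap {R : Type u} [Ring R] [Algebra k R] {n : ℕ}
    (ρ : Γ →ₐ[k] Matrix (Fin n) (Fin n) R) {L L' : FDMod k R}
    (θ : L.carrier →ₗ[R] L'.carrier) :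
    (tensorObj ρ L).carrier →ₗ[Γ] (tensorObj ρ L').carrier where
  toFun x i := θ (x i)
  map_add' x y := funext fun i => map_add θ (x i) (y i)
  map_smul' γ x := (θ.mapMatrixModule (Fin n)).map_smul (ρ γ) x

/-- The functor `T ⊗_R - : R-mod → Γ-mod` for the `Γ`-`R`-bimodule `T = Rⁿ`. -/
def tensorFunctor {R : Type u} [Ring R] [Algebra k R] {n : ℕ}
    (ρ : Γ →ₐ[k] Matrix (Fin n) (Fin n) R) : FDMod k R ⥤ FDMod k Γ where
  obj L := tensorObj ρ L
  map θ := tensorMap ρ θ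
  map_id _ := rfl
  map_comp _ _ := rfl

/-- The bocs is wild through a bimodule of rank `n`: there is a `Γ`-`k⟨x,y⟩`-bimodule `T`, free of
rank `n` over `k⟨x,y⟩`, such that the functor `T ⊗ - : k⟨x,y⟩-mod → R(A)` preserves isomorphism
classes (non-isomorphic modules go to non-isomorphic representations) and indecomposability. It
sends a module of dimension `d` to a representation of dimension `n * d`. -/
def Bocs.IsWildOfRank (A : Bocs k Γ Ω) (n : ℕ) : Prop :=
  ∃ ρ : Γ →ₐ[k] Matrix (Fin n) (Fin n) (FreeAlgebra k (Fin 2)),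
    (∀ L L' : FDMod k (FreeAlgebra k (Fin 2)),
      Nonempty ((tensorFunctor ρ ⋙ A.fromModules).obj L ≅
        (tensorFunctor ρ ⋙ A.fromModules).obj L') → Nonempty (L ≅ L')) ∧
    ∀ L : FDMod k (FreeAlgebra k (Fin 2)),
      Indecomposable L → Indecomposable ((tensorFunctor ρ ⋙ A.fromModules).obj L)

/-- The bocs is wild. -/
def Bocs.IsWild (A : Bocs k Γ Ω) : Prop :=
  ∃ n : ℕ, A.IsWildOfRank n

end Rep

/-! ### Layers -/

/-- The algebra `B` is `k` (a trivial vertex). -/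
def IsTrivialVertex (k B : Type u) [Field k] [CommRing B] [Algebra k B] : Prop :=
  Function.Bijective (algebraMap k B)

/-- The algebra `B` is `k[λ, g(λ)⁻¹]` for some non-zero polynomial `g` (a vertex carrying a
parameter `λ`). -/
def IsParameterVertex (k B : Type u) [Field k] [CommRing B] [Algebra k B] : Prop :=
  ∃ g : k[X], g ≠ 0 ∧ Nonempty (Localization.Away g ≃ₐ[k] B)

section Layer

variable {k Γ Ω : Type u} [Field k] [Ring Γ] [Algebra k Γ] [AddCommGroup Ω] [Module k Ω]
  [Module Γ Ω] [Module Γᵐᵒᵖ Ω] [SMulCommClass Γ Γᵐᵒᵖ Ω] [IsScalarTower k Γ Ω]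
  [IsScalarTower k Γᵐᵒᵖ Ω]

/-- The action of `Γ ⊗ₖ Γ` on the bimodule `Ω`: `(x ⊗ y) · w = x w y`. -/
def sandwich : Γ ⊗[k] Γ →ₗ[k] Ω →ₗ[k] Ω :=
  TensorProduct.lift
    (LinearMap.mk₂ k (fun x y => LinearMap.comp (DistribSMul.toLinearMap k Ω x)
        (DistribSMul.toLinearMap k Ω (op y)))
      (fun x x' y => LinearMap.ext fun w => add_smul x x' (op y • w))
      (fun c x y => LinearMap.ext fun w => smul_assoc c x (op y • w))
      (fun x y y' => LinearMap.ext fun w => by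
        change x • op (y + y') • w = x • op y • w + x • op y' • w
        rw [MulOpposite.op_add, add_smul, smul_add])
      (fun c x y => LinearMap.ext fun w => by
        change x • op (c • y) • w = c • x • op y • w
        rw [MulOpposite.op_smul, smul_assoc, smul_comm]))

/-- A layer `(Γ'; ω; a₁, …, aₙ; v₁, …, vₘ)` of the bocs `A = (Γ, Ω)`. Composition is written from
right to left: an arrow from `P` to `Q` is an element `a` with `a = e_Q a e_P`, so that a left
`Γ`-module `M` gives linear maps `e_P M → e_Q M`. Arrows are numbered from `0`. -/
structure Layer (A : Bocs k Γ Ω) where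
  /-- number of vertices (indecomposable objects of `Γ'`) -/
  vertices : ℕ
  /-- the endomorphism algebras `Γ'(P, P)` -/
  B : Fin vertices → Type u
  [commRing : ∀ P, CommRing (B P)]
  [algebra : ∀ P, Algebra k (B P)]
  /-- `Γ' = ∏ Γ'(P, P)` is a minimal category -/
  minimal : ∀ P, IsTrivialVertex k (B P) ∨ IsParameterVertex k (B P)
  /-- the inclusion of `Γ'` in `Γ` -/
  incl : (∀ P, B P) →ₐ[k] Γ
  /-- number of solid arrows -/
  n : ℕ
  src : Fin n → Fin vertices
  tgt : Fin n → Fin vertices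
  /-- the solid arrows -/
  a : Fin n → Γ
  a_mem : ∀ i, incl (Pi.single (tgt i) 1) * a i * incl (Pi.single (src i) 1) = a i
  /-- `Γ` is freely generated by the solid arrows over `Γ'` -/
  free : ∀ (C : Type u) [Ring C] [Algebra k C] (h : (∀ P, B P) →ₐ[k] C) (c : Fin n → C),
    (∀ i, h (Pi.single (tgt i) 1) * c i * h (Pi.single (src i) 1) = c i) →
    ∃! H : Γ →ₐ[k] C, H.comp incl = h ∧ ∀ i, H (a i) = c i
  /-- the reflector `ω : Γ' → Ω`, a map of `Γ'`-`Γ'`-bimodules -/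
  ω : (∀ P, B P) →ₗ[k] Ω
  ω_mul : ∀ b b', ω (b * b') = incl b • ω b'
  ω_mul_op : ∀ b b', ω (b' * b) = op (incl b) • ω b'
  counit_ω : ∀ b, A.counit (ω b) = incl b
  comul_ω : ∀ P, A.comul (ω (Pi.single P 1)) = bal₂ (ω (Pi.single P 1)) (ω (Pi.single P 1))
  /-- number of dotted arrows -/
  m : ℕ
  dsrc : Fin m → Fin vertices
  dtgt : Fin m → Fin vertices
  /-- the dotted arrows, elements of the kernel of the counit -/
  v : Fin m → Ω
  v_mem : ∀ j, incl (Pi.single (dtgt j) 1) • op (incl (Pi.single (dsrc j) 1)) • v j = v j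
  counit_v : ∀ j, A.counit (v j) = 0
  /-- the kernel of the counit is the `Γ`-`Γ`-bimodule freely generated by the dotted arrows: each
  of its elements is uniquely `∑ⱼ tⱼ · vⱼ` with `tⱼ ∈ Γ e_{dtgt j} ⊗ₖ e_{dsrc j} Γ` -/
  v_free : ∀ x : Ω, A.counit x = 0 → ∃! t : Fin m → Γ ⊗[k] Γ,
    (∀ j, t j * (incl (Pi.single (dtgt j) 1) ⊗ₜ[k] 1) = t j ∧
      (1 ⊗ₜ[k] incl (Pi.single (dsrc j) 1)) * t j = t j) ∧
    ∑ j, sandwich (t j) (v j) = x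
  /-- triangularity: the differential `aᵢ ω - ω aᵢ` of `aᵢ` lies in the bimodule generated by the
  dotted arrows over the subalgebra generated by `Γ'` and the preceding solid arrows -/
  triangular : ∀ i, a i • ω 1 - op (a i) • ω 1 ∈
    Submodule.span k {x : Ω | ∃ γ ∈ Algebra.adjoin k (Set.range incl ∪ a '' {i' | i' < i}),
      ∃ γ' ∈ Algebra.adjoin k (Set.range incl ∪ a '' {i' | i' < i}),
      ∃ j, x = γ • op γ' • v j}

attribute [instance] Layer.commRing Layer.algebra

namespace Layer

variable {A : Bocs k Γ Ω} (L : Layer A)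

/-- The differential `δ : Γ → Ω`, `δ(γ) = γ ω - ω γ`, where `ω` is the value of the reflector at
`1`. -/
def δ (γ : Γ) : Ω := γ • L.ω 1 - op γ • L.ω 1

/-- The inclusion of `Γ'(P, P)` in `Γ`. -/
def vertexIncl (P : Fin L.vertices) : L.B P →ₗ[k] Γ :=
  L.incl.toLinearMap.comp (LinearMap.single k L.B P)

/-- For `f = f(λ, μ)` in `Γ'(P, P) ⊗ₖ Γ'(Q, Q)`, which is `k[λ, μ, g_P(λ)⁻¹, g_Q(μ)⁻¹]` when `P` and
`Q` carry the parameters `λ` and `μ`, and for `w ∈ Ω`, the element `f(λ, μ) w`: here `λ` acts on the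
side of the source `P` of an arrow from `P` to `Q`, and `μ` on the side of its target `Q`, that is
`(λⁱ μʲ) w = μʲ w λⁱ`. -/
def coeffMul (P Q : Fin L.vertices) (f : L.B P ⊗[k] L.B Q) (w : Ω) : Ω :=
  sandwich (TensorProduct.comm k Γ Γ
    (TensorProduct.map (L.vertexIncl P) (L.vertexIncl Q) f)) w

end Layer

end Layer

end LayeredBocs

/-!
The bimodule `T` is supported at the source `P` and the target `Q` of the first solid arrow: `Γ'`
acts through Jordan blocks (`BlockDatum`), the arrow acts by a matrix with entries in `k⟨x,y⟩`, and
all other solid arrows act by zero. As `Γ` is freely generated over `Γ'`, there are no relations to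
check.

Let `ω₁` be the value of the reflector at `1`. Evaluation of a morphism `φ` of representations at
`ω₁` is multiplicative, because `ω` is grouplike (`Layer.evalFunctorial`). The value `φ(ω₁)`
commutes with `Γ'`, and `a φ(ω₁) - φ(ω₁) a = φ(δ a)` for each arrow `a`. For `T ⊗ M ⟶ T ⊗ N` this
value is a matrix of linear maps `M → N`. If that matrix is always strictly triangular up to a
constant diagonal `θ` which is `k⟨x,y⟩`-linear, then `θ` depends multiplicatively on `φ`;
isomorphisms give isomorphisms `θ`, and an idempotent with `θ = 0` is nilpotent, hence zero
(`Bocs.EvalFunctorial.isWildOfRank`). So everything reduces to linear equations for the entries of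
the matrix (`BlockDatum.IsMorphismMatrix`).

If `δ(a₁) = f(λ, μ) v₁` with `f` not invertible, then `f` vanishes at some `(λ₀, μ₀)` by the
Nullstellensatz. Take Jordan blocks with eigenvalue `λ₀` at `P` and `μ₀` at `Q`, of pairwise
different sizes. Intertwiners of Jordan blocks are Toeplitz, and those between blocks of different
sizes are nilpotent, so that the matrix is triangular with one diagonal entry for each block
(`BlockDatum.isWildOfRank_of_isJordan`). Between a block at `P` and a block at `Q` the commutator
with the arrow is a multiple of `f`, seen as a power series at `(λ₀, μ₀)` acting on
`k⟦λ, μ⟧ / (λ ^ l, μ ^ l')`, about which nothing else is known; each functional that vanishes on the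
multiples of `f` therefore gives an equation.

* If `f` has a non-zero linear term in `λ`, then `f = 0` is a curve `λ = h(μ)`, and the coefficients
  of `μ ^ w` along the curve are such functionals (`exists_functionals_of_coeff_ne_zero`). Blocks of
  sizes `3, 5` and `2, 4, 6` are joined by an arrow in the shape of a complete bipartite graph, with
  coefficients `1, 1, 1` and `1, x, y` (`datumTwoThree`). The off-diagonal entries in the
  equations vanish, by the description of the intertwiners, and the equations then equate the five
  diagonal entries to one map, which commutes with `x` and `y`. A non-zero linear term in `μ` is
  treated dually (`datumThreeTwo`).
* If `f` has no linear term, then the coefficients of both `λ` and `μ` are such functionals, so that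
  blocks of sizes `2, 3` and `4, 5` suffice (`datumTwoTwo`).

If `δ(a₁) = 0` and exactly one of the two vertices carries a parameter, then five different
eigenvalues there make the restriction of the arrow a representation of a star with five arms, and
`datumStar` and `datumCostar` are the wild family of configurations `(1, 0)`, `(0, 1)`, `(1, 1)`,
`(1, x)`, `(1, y)` of five subspaces, or functionals.
-/

namespace LayeredBocs

/-! ### Matrix entries of linear maps -/

section Entry

variable {k : Type*} [Field k] {ι V W U : Type*} [Fintype ι] [DecidableEq ι] [AddCommGroup V]
  [Module k V] [AddCommGroup W] [Module k W] [AddCommGroup U] [Module k U]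

/-- The `(a, b)` entry of a linear map `V^ι → W^ι`. -/
def entry (Φ : (ι → V) →ₗ[k] (ι → W)) (a b : ι) : V →ₗ[k] W :=
  LinearMap.proj a ∘ₗ Φ ∘ₗ LinearMap.single k (fun _ => V) b

lemma entry_apply (Φ : (ι → V) →ₗ[k] (ι → W)) (a b : ι) (x : V) :
    entry Φ a b x = Φ (Pi.single b x) a := rfl

lemma apply_eq_sum_entry (Φ : (ι → V) →ₗ[k] (ι → W)) (x : ι → V) (a : ι) :
    Φ x a = ∑ b, entry Φ a b (x b) := by
  conv_lhs => rw [← Finset.univ_sum_single x, map_sum, Finset.sum_apply]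
  rfl

lemma entry_comp (Ψ : (ι → W) →ₗ[k] (ι → U)) (Φ : (ι → V) →ₗ[k] (ι → W)) (a b : ι) :
    entry (Ψ ∘ₗ Φ) a b = ∑ c, entry Ψ a c ∘ₗ entry Φ c b := by
  ext x
  rw [entry_apply, LinearMap.comp_apply, apply_eq_sum_entry, LinearMap.sum_apply]
  rfl

lemma entry_id (a b : ι) :
    entry (LinearMap.id : (ι → V) →ₗ[k] (ι → V)) a b = if a = b then LinearMap.id else 0 := by
  ext x
  rw [entry_apply, LinearMap.id_apply, Pi.single_apply]
  split_ifs <;> rfl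

lemma eq_zero_of_entry_eq_zero {Φ : (ι → V) →ₗ[k] (ι → W)} (h : ∀ a b, entry Φ a b = 0) :
    Φ = 0 := by
  refine LinearMap.ext fun x => funext fun a => ?_
  rw [apply_eq_sum_entry]
  simp [h]

/-- An idempotent block matrix that is strictly triangular for some grading vanishes. -/
lemma eq_zero_of_idempotent_of_strictly_graded {Φ : (ι → V) →ₗ[k] (ι → V)} (deg : ι → ℕ)
    (hΦ : Φ ∘ₗ Φ = Φ) (h : ∀ a b, deg a ≤ deg b → entry Φ a b = 0) : Φ = 0 := by
  have key : ∀ d a b, deg a ≤ deg b + d → entry Φ a b = 0 := by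
    intro d
    induction d with
    | zero => exact h
    | succ d ih =>
      intro a b hab
      rw [← hΦ, entry_comp]
      refine Finset.sum_eq_zero fun c _ => ?_
      by_cases hc : deg c ≤ deg b
      · rw [h c b hc, LinearMap.comp_zero]
      · rw [ih a c (by omega), LinearMap.zero_comp]
  exact eq_zero_of_entry_eq_zero fun a b => key (deg a) a b (by omega)

end Entry

/-! ### Decompositions of modules and of representations -/

section Criterion

variable {k Γ Ω : Type u} [Field k] [Ring Γ] [Algebra k Γ] [AddCommGroup Ω] [Module k Ω]
  [Module Γ Ω] [Module Γᵐᵒᵖ Ω] [SMulCommClass Γ Γᵐᵒᵖ Ω] [IsScalarTower k Γ Ω]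
  [IsScalarTower k Γᵐᵒᵖ Ω]

/-- An idempotent endomorphism of an indecomposable module is `0` or `1`: otherwise its range and
its kernel give a decomposition. -/
lemma FDMod.idempotent_eq_zero_or_one {R : Type u} [Ring R] [Algebra k R] {L : FDMod k R}
    (hL : Indecomposable L) (θ : L.carrier →ₗ[R] L.carrier) (hθ : θ ∘ₗ θ = θ) :
    θ = 0 ∨ θ = LinearMap.id := by
  let Y : FDMod k R :=
    { carrier := LinearMap.range θ
      finiteDimensional :=
        FiniteDimensional.of_injective (θ.range.subtype.restrictScalars k)
          (Submodule.injective_subtype _) }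
  let Z : FDMod k R :=
    { carrier := LinearMap.ker θ
      finiteDimensional :=
        FiniteDimensional.of_injective (θ.ker.subtype.restrictScalars k)
          (Submodule.injective_subtype _) }
  have hθx : ∀ x, θ (θ x) = θ x := fun x => LinearMap.congr_fun hθ x
  have hYZ : ∀ x : Y.carrier, θ x.1 = x.1 := by
    rintro ⟨_, y, rfl⟩
    exact hθx y
  let b : BinaryBicone Y Z :=
    { pt := L
      fst := θ.rangeRestrict
      snd := LinearMap.codRestrict (LinearMap.ker θ) (LinearMap.id - θ) (fun x => by
        simp [hθx])
      inl := (LinearMap.range θ).subtype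
      inr := (LinearMap.ker θ).subtype
      inl_fst := LinearMap.ext fun x : Y.carrier => Subtype.ext (hYZ x)
      inl_snd := LinearMap.ext fun x : Y.carrier => Subtype.ext (by
        change x.1 - θ x.1 = 0
        rw [hYZ x, sub_self])
      inr_fst := LinearMap.ext fun x : Z.carrier => Subtype.ext x.2
      inr_snd := LinearMap.ext fun x : Z.carrier => Subtype.ext (by
        change x.1 - θ x.1 = x.1
        rw [show θ x.1 = 0 from x.2, sub_zero]) }
  have htot : b.fst ≫ b.inl + b.snd ≫ b.inr = 𝟙 b.pt :=
    LinearMap.ext fun x : L.carrier => by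
      change θ x + (x - θ x) = x
      abel
  rcases hL.2 Y Z (biprod.uniqueUpToIso Y Z (isBinaryBilimitOfTotal b htot)) with h | h
  · left
    refine LinearMap.ext fun x => ?_
    have h1 : (LinearMap.id : Y.carrier →ₗ[R] Y.carrier) = 0 := (IsZero.iff_id_eq_zero Y).1 h
    exact congrArg Subtype.val (LinearMap.congr_fun h1 ⟨θ x, x, rfl⟩)
  · right
    refine LinearMap.ext fun x => ?_
    have h1 : (LinearMap.id : Z.carrier →ₗ[R] Z.carrier) = 0 := (IsZero.iff_id_eq_zero Z).1 h
    have h2 : x - θ x = 0 := congrArg Subtype.val (LinearMap.congr_fun h1 ⟨x - θ x, by simp [hθx]⟩)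
    exact (sub_eq_zero.1 h2).symm

/-- Evaluation of morphisms of representations at `ω₁ ∈ Ω` is a functor to vector spaces. -/
structure Bocs.EvalFunctorial (A : Bocs k Γ Ω) (ω₁ : Ω) : Prop where
  counit_eq : A.counit ω₁ = 1
  compHom_apply : ∀ {M N E : FDMod k Γ} (φ : bimodHom Ω M N) (ψ : bimodHom Ω N E),
    (A.compHom φ ψ).1 ω₁ = (ψ.1 ω₁).comp (φ.1 ω₁)

/-- The value at `ω₁` of a morphism of representations. -/
def Bocs.Rep.eval {A : Bocs k Γ Ω} (ω₁ : Ω) {M N : A.Rep} (f : M ⟶ N) :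
    M.obj.carrier →ₗ[k] N.obj.carrier :=
  (show bimodHom Ω M.obj N.obj from f).1 ω₁

namespace Bocs.EvalFunctorial

open Bocs.Rep

variable {A : Bocs k Γ Ω} {ω₁ : Ω} (hω : A.EvalFunctorial ω₁)
include hω

lemma eval_comp {M N E : A.Rep} (f : M ⟶ N) (g : N ⟶ E) :
    eval ω₁ (f ≫ g) = eval ω₁ g ∘ₗ eval ω₁ f :=
  hω.compHom_apply _ _

lemma eval_id (M : A.Rep) : eval ω₁ (𝟙 M) = LinearMap.id :=
  LinearMap.ext fun m => by
    change A.counit ω₁ • m = m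
    rw [hω.counit_eq, one_smul]

lemma isZero {M : A.Rep} (h : eval ω₁ (𝟙 M) = 0) : IsZero M := by
  rw [hω.eval_id] at h
  refine (IsZero.iff_id_eq_zero M).2 (Subtype.ext (LinearMap.ext₂ fun x m => ?_))
  change A.counit x • m = 0
  rw [show m = 0 from LinearMap.congr_fun h m, smul_zero]

/-- If the idempotent endomorphism projecting to a direct summand vanishes at `ω₁`, then the summand
is zero. -/
lemma isZero_of_retract {M N : A.Rep} (p : M ⟶ N) (q : N ⟶ M) (hqp : q ≫ p = 𝟙 N)
    (h : eval ω₁ (p ≫ q) = 0) : IsZero N := by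
  refine hω.isZero ?_
  have h1 : 𝟙 N = q ≫ (p ≫ q) ≫ p := by
    rw [Category.assoc, reassoc_of% hqp, hqp]
  rw [h1, hω.eval_comp, hω.eval_comp, h, LinearMap.comp_zero, LinearMap.zero_comp]

end Bocs.EvalFunctorial

/-- The `(a, b)` entry of the value at `ω₁` of a morphism `T ⊗ L ⟶ T ⊗ L'`, where `T` is free of
rank `n`, so that `T ⊗ L = Lⁿ`. -/
def evalEntry {A : Bocs k Γ Ω} (ω₁ : Ω) {R : Type u} [Ring R] [Algebra k R] {n : ℕ}
    {ρ : Γ →ₐ[k] Matrix (Fin n) (Fin n) R} {L L' : FDMod k R}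
    (f : (tensorFunctor ρ ⋙ A.fromModules).obj L ⟶ (tensorFunctor ρ ⋙ A.fromModules).obj L')
    (a b : Fin n) : L.carrier →ₗ[k] L'.carrier :=
  entry (ι := Fin n) (V := L.carrier) (W := L'.carrier) (Bocs.Rep.eval ω₁ f) a b

section

variable {A : Bocs k Γ Ω} {ω₁ : Ω} (hω : A.EvalFunctorial ω₁) {R : Type u} [Ring R] [Algebra k R]
  {n : ℕ} {ρ : Γ →ₐ[k] Matrix (Fin n) (Fin n) R} {L L' L'' : FDMod k R}

lemma evalEntry_add
    (f g : (tensorFunctor ρ ⋙ A.fromModules).obj L ⟶ (tensorFunctor ρ ⋙ A.fromModules).obj L')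
    (a b : Fin n) : evalEntry ω₁ (f + g) a b = evalEntry ω₁ f a b + evalEntry ω₁ g a b := rfl

lemma evalEntry_zero (a b : Fin n) : evalEntry ω₁ (0 : (tensorFunctor ρ ⋙ A.fromModules).obj L ⟶
    (tensorFunctor ρ ⋙ A.fromModules).obj L') a b = 0 := rfl

include hω

lemma evalEntry_comp
    (f : (tensorFunctor ρ ⋙ A.fromModules).obj L ⟶ (tensorFunctor ρ ⋙ A.fromModules).obj L')
    (g : (tensorFunctor ρ ⋙ A.fromModules).obj L' ⟶ (tensorFunctor ρ ⋙ A.fromModules).obj L'')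
    (a b : Fin n) :
    evalEntry ω₁ (f ≫ g) a b = ∑ c, evalEntry ω₁ g a c ∘ₗ evalEntry ω₁ f c b := by
  rw [evalEntry, hω.eval_comp]
  exact entry_comp (ι := Fin n) (V := L.carrier) (W := L'.carrier) (U := L''.carrier) _ _ a b

lemma evalEntry_id (a b : Fin n) :
    evalEntry ω₁ (𝟙 ((tensorFunctor ρ ⋙ A.fromModules).obj L)) a b =
      if a = b then LinearMap.id else 0 := by
  rw [evalEntry, hω.eval_id]
  exact entry_id (ι := Fin n) (V := L.carrier) a b

/-- A criterion for wildness: for every morphism between representations of the form `T ⊗ L`, the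
matrix of its value at `ω₁` is strictly triangular for some grading of the coordinates, up to a
diagonal that repeats a single `k⟨x,y⟩`-linear map. The diagonal entry then recovers the morphism of
`k⟨x,y⟩`-modules up to a nilpotent part. -/
theorem Bocs.EvalFunctorial.isWildOfRank (hn : 0 < n)
    (ρ : Γ →ₐ[k] Matrix (Fin n) (Fin n) (FreeAlgebra k (Fin 2))) (deg : Fin n → ℕ)
    (H : ∀ (L L' : FDMod k (FreeAlgebra k (Fin 2)))
      (f : (tensorFunctor ρ ⋙ A.fromModules).obj L ⟶ (tensorFunctor ρ ⋙ A.fromModules).obj L'),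
      ∃ θ : L.carrier →ₗ[FreeAlgebra k (Fin 2)] L'.carrier,
        (∀ a, evalEntry ω₁ f a a = θ.restrictScalars k) ∧
        ∀ a b, a ≠ b → deg a ≤ deg b → evalEntry ω₁ f a b = 0) :
    A.IsWildOfRank n := by
  let t : Fin n := ⟨0, hn⟩
  have hdiag : ∀ {L L' L'' : FDMod k (FreeAlgebra k (Fin 2))}
      (f : (tensorFunctor ρ ⋙ A.fromModules).obj L ⟶ (tensorFunctor ρ ⋙ A.fromModules).obj L')
      (g : (tensorFunctor ρ ⋙ A.fromModules).obj L' ⟶ (tensorFunctor ρ ⋙ A.fromModules).obj L''),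
      evalEntry ω₁ (f ≫ g) t t = evalEntry ω₁ g t t ∘ₗ evalEntry ω₁ f t t := by
    intro L L' L'' f g
    rw [evalEntry_comp hω]
    refine Finset.sum_eq_single t (fun c _ hc => ?_) (by simp)
    obtain ⟨_, -, h1⟩ := H _ _ f
    obtain ⟨_, -, h2⟩ := H _ _ g
    rcases le_total (deg c) (deg t) with h | h
    · rw [h1 c t hc h, LinearMap.comp_zero]
    · rw [h2 t c hc.symm h, LinearMap.zero_comp]
  refine ⟨ρ, ?_, ?_⟩
  · rintro L L' ⟨i⟩
    obtain ⟨θ, hθ, -⟩ := H _ _ i.hom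
    obtain ⟨η, hη, -⟩ := H _ _ i.inv
    have h1 := hdiag i.hom i.inv
    have h2 := hdiag i.inv i.hom
    rw [i.hom_inv_id, evalEntry_id hω, if_pos rfl, hθ, hη] at h1
    rw [i.inv_hom_id, evalEntry_id hω, if_pos rfl, hθ, hη] at h2
    exact ⟨{ hom := θ
             inv := η
             hom_inv_id := LinearMap.ext fun x => (LinearMap.congr_fun h1 x).symm
             inv_hom_id := LinearMap.ext fun x => (LinearMap.congr_fun h2 x).symm }⟩
  · intro L hL
    have hsub : ¬ ∀ x : L.carrier, x = 0 := fun h =>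
      hL.1 ((IsZero.iff_id_eq_zero L).2 (LinearMap.ext fun x => h x))
    refine ⟨fun h0 => hsub fun x => ?_, fun Y Z i => ?_⟩
    · have h1 := evalEntry_id hω (ρ := ρ) (L := L) t t
      rw [(IsZero.iff_id_eq_zero _).1 h0, evalEntry_zero, if_pos rfl] at h1
      exact (LinearMap.congr_fun h1 x).symm
    · -- An idempotent endomorphism with zero diagonal vanishes at `ω₁`.
      have key : ∀ e : (tensorFunctor ρ ⋙ A.fromModules).obj L ⟶
          (tensorFunctor ρ ⋙ A.fromModules).obj L, e ≫ e = e → evalEntry ω₁ e t t = 0 →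
            Bocs.Rep.eval ω₁ e = 0 := by
        intro e he het
        obtain ⟨θ, hθ, hdeg⟩ := H _ _ e
        refine eq_zero_of_idempotent_of_strictly_graded (k := k) (ι := Fin n) (V := L.carrier) deg
          ((hω.eval_comp e e).symm.trans (by rw [he])) fun a b hab => ?_
        by_cases h : a = b
        · exact h ▸ (hθ a).trans ((hθ t).symm.trans het)
        · exact hdeg a b h hab
      have hY : (biprod.inl ≫ i.inv) ≫ i.hom ≫ biprod.fst = 𝟙 Y := by simp
      have hZ : (biprod.inr ≫ i.inv) ≫ i.hom ≫ biprod.snd = 𝟙 Z := by simp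
      have hYY : ((i.hom ≫ biprod.fst) ≫ biprod.inl ≫ i.inv) ≫
          (i.hom ≫ biprod.fst) ≫ biprod.inl ≫ i.inv =
            (i.hom ≫ biprod.fst) ≫ biprod.inl ≫ i.inv := by simp
      have hZZ : ((i.hom ≫ biprod.snd) ≫ biprod.inr ≫ i.inv) ≫
          (i.hom ≫ biprod.snd) ≫ biprod.inr ≫ i.inv =
            (i.hom ≫ biprod.snd) ≫ biprod.inr ≫ i.inv := by simp
      have hsum : (i.hom ≫ biprod.fst) ≫ biprod.inl ≫ i.inv +
          (i.hom ≫ biprod.snd) ≫ biprod.inr ≫ i.inv = 𝟙 _ := by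
        have h1 : i.hom ≫ (biprod.fst ≫ biprod.inl + biprod.snd ≫ biprod.inr) ≫ i.inv = 𝟙 _ := by
          rw [biprod.total, Category.id_comp, i.hom_inv_id]
        rw [← h1]
        simp only [Preadditive.add_comp, Preadditive.comp_add, Category.assoc]
      obtain ⟨θ, hθ, -⟩ := H _ _ ((i.hom ≫ biprod.fst) ≫ biprod.inl ≫ i.inv)
      have hθ2 : θ ∘ₗ θ = θ := by
        have h1 := hdiag ((i.hom ≫ biprod.fst) ≫ biprod.inl ≫ i.inv)
          ((i.hom ≫ biprod.fst) ≫ biprod.inl ≫ i.inv)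
        rw [hYY, hθ] at h1
        exact LinearMap.ext fun x => (LinearMap.congr_fun h1 x).symm
      rcases FDMod.idempotent_eq_zero_or_one hL θ hθ2 with h | h
      · left
        refine hω.isZero_of_retract _ _ hY (key _ hYY ?_)
        rw [hθ, h]
        rfl
      · right
        refine hω.isZero_of_retract _ _ hZ (key _ hZZ ?_)
        have h1 := evalEntry_id hω (ρ := ρ) (L := L) t t
        rw [← hsum, evalEntry_add, hθ, h, if_pos rfl] at h1
        exact add_eq_left.1 h1

end

end Criterion

end LayeredBocs

namespace LayeredBocs

/-! ### Toeplitz matrices of power series -/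

section Toeplitz

variable {k : Type*} [Field k] {H : Type*} [AddCommGroup H] [Module k H]

/-- The action of a power series on `k⟦X⟧ / (X ^ l)`, in the basis `1, X, …, X ^ (l - 1)`: a lower
triangular Toeplitz matrix. -/
noncomputable def toeplitz (l : ℕ) (p : PowerSeries k) : Matrix (Fin l) (Fin l) k :=
  Matrix.of fun m' m => if m ≤ m' then PowerSeries.coeff (m' - m : ℕ) p else 0

lemma toeplitz_apply (l : ℕ) (p : PowerSeries k) (m' m : Fin l) :
    toeplitz l p m' m = if m ≤ m' then PowerSeries.coeff (m' - m : ℕ) p else 0 := rfl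

lemma sum_toeplitz_left (l : ℕ) (p : PowerSeries k) (G : ℕ → H) (m' : Fin l) :
    ∑ n : Fin l, toeplitz l p m' n • G n =
      ∑ d ∈ Finset.range (m' + 1), PowerSeries.coeff d p • G (m' - d) := by
  have h1 : ∑ n : Fin l, toeplitz l p m' n • G n =
      ∑ n ∈ Finset.range l, if n ≤ m' then PowerSeries.coeff (m' - n : ℕ) p • G n else 0 := by
    rw [← Fin.sum_univ_eq_sum_range
      (fun n => if n ≤ (m' : ℕ) then PowerSeries.coeff (m' - n : ℕ) p • G n else 0) l]
    refine Finset.sum_congr rfl fun n _ => ?_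
    rw [toeplitz_apply, ite_smul, zero_smul]
    rfl
  have h2 : (Finset.range l).filter (· ≤ (m' : ℕ)) = Finset.range (m' + 1) := by
    ext n
    simp only [Finset.mem_filter, Finset.mem_range]
    omega
  rw [h1, ← Finset.sum_filter, h2,
    ← Finset.sum_range_reflect (fun d => PowerSeries.coeff d p • G (m' - d))]
  refine Finset.sum_congr rfl fun n hn => ?_
  have := Finset.mem_range.1 hn
  congr 2
  omega

lemma sum_toeplitz_right (l : ℕ) (p : PowerSeries k) (G : ℕ → H) (m : Fin l) :
    ∑ n : Fin l, toeplitz l p n m • G n =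
      ∑ e ∈ Finset.range (l - m), PowerSeries.coeff e p • G (m + e) := by
  have h1 : ∑ n : Fin l, toeplitz l p n m • G n =
      ∑ n ∈ Finset.range l, if m ≤ n then PowerSeries.coeff (n - m : ℕ) p • G n else 0 := by
    rw [← Fin.sum_univ_eq_sum_range
      (fun n => if (m : ℕ) ≤ n then PowerSeries.coeff (n - m : ℕ) p • G n else 0) l]
    refine Finset.sum_congr rfl fun n _ => ?_
    rw [toeplitz_apply, ite_smul, zero_smul]
    rfl
  have h2 : (Finset.range l).filter ((m : ℕ) ≤ ·) = Finset.Ico (m : ℕ) l := by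
    ext n
    simp only [Finset.mem_filter, Finset.mem_range, Finset.mem_Ico]
    omega
  rw [h1, ← Finset.sum_filter, h2, Finset.sum_Ico_eq_sum_range]
  refine Finset.sum_congr rfl fun n _ => ?_
  rw [Nat.add_sub_cancel_left]

/-- The representation of `k⟦X⟧` on `k⟦X⟧ / (X ^ l)`. -/
noncomputable def toeplitzHom (l : ℕ) : PowerSeries k →ₐ[k] Matrix (Fin l) (Fin l) k :=
  AlgHom.ofLinearMap
    { toFun := toeplitz l
      map_add' := fun p q => by
        ext m' m
        simp only [toeplitz_apply, Matrix.add_apply, map_add]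
        split_ifs <;> simp
      map_smul' := fun c p => by
        ext m' m
        simp only [toeplitz_apply, Matrix.smul_apply, map_smul, RingHom.id_apply]
        split_ifs <;> simp }
    (by
      ext m' m
      change toeplitz l 1 m' m = _
      rw [toeplitz_apply, PowerSeries.coeff_one, Matrix.one_apply]
      split_ifs
      all_goals first
        | rfl
        | exfalso; omega)
    (fun p q => by
      ext m' m
      change toeplitz l (p * q) m' m = ∑ n : Fin l, toeplitz l p m' n * toeplitz l q n m
      have h := sum_toeplitz_left l p
        (fun n => if (m : ℕ) ≤ n then PowerSeries.coeff (n - m : ℕ) q else 0) m'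
      refine Eq.trans ?_ h.symm
      rw [toeplitz_apply]
      split_ifs with hm
      · rw [PowerSeries.coeff_mul, Finset.Nat.sum_antidiagonal_eq_sum_range_succ
          (fun a b => PowerSeries.coeff a p * PowerSeries.coeff b q),
          ← Finset.sum_subset (Finset.range_mono (show (m' - m : ℕ).succ ≤ m' + 1 by omega))]
        · refine Finset.sum_congr rfl fun d hd => ?_
          have hd := Finset.mem_range.1 hd
          rw [if_pos (by omega), smul_eq_mul]
          congr 3
          omega
        · intro d hd' hd
          have hd' := Finset.mem_range.1 hd'
          have hd : ¬ d < (m' - m : ℕ).succ := fun h => hd (Finset.mem_range.2 h)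
          rw [if_neg (by have : (m : ℕ) ≤ m' := hm; omega), smul_zero]
      · refine (Finset.sum_eq_zero fun d _ => ?_).symm
        rw [if_neg (by have : ¬ (m : ℕ) ≤ m' := hm; omega), smul_zero])

lemma toeplitzHom_apply (l : ℕ) (p : PowerSeries k) : toeplitzHom l p = toeplitz l p := rfl

variable {B : Type*} [Ring B] [Algebra k B] {I : Type*} [Fintype I] [DecidableEq I]

/-- The block diagonal representation `⨁ᵢ k⟦X⟧ / (X ^ (l i))` of `B`, where `B` acts on the `i`-th
summand through `S i : B → k⟦X⟧`. -/
noncomputable def blockToeplitz (l : I → ℕ) (S : I → B →ₐ[k] PowerSeries k) :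
    B →ₐ[k] Matrix (Σ i, Fin (l i)) (Σ i, Fin (l i)) k where
  toFun b := Matrix.blockDiagonal' fun i => toeplitz (l i) (S i b)
  map_one' := by
    rw [← Matrix.blockDiagonal'_one]
    congr 1
    funext i
    rw [map_one, ← toeplitzHom_apply, map_one]
    rfl
  map_mul' b b' := by
    rw [← Matrix.blockDiagonal'_mul]
    congr 1
    funext i
    rw [map_mul, ← toeplitzHom_apply, map_mul]
    rfl
  map_zero' := by
    rw [← Matrix.blockDiagonal'_zero]
    congr 1
    funext i
    rw [map_zero, ← toeplitzHom_apply, map_zero]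
    rfl
  map_add' b b' := by
    rw [← Matrix.blockDiagonal'_add]
    congr 1
    funext i
    rw [map_add, ← toeplitzHom_apply, map_add]
    rfl
  commutes' c := by
    rw [Algebra.algebraMap_eq_smul_one (A := Matrix _ _ k), ← Matrix.blockDiagonal'_one,
      ← Matrix.blockDiagonal'_smul]
    congr 1
    funext i
    change toeplitzHom (l i) (S i (algebraMap k B c)) = c • 1
    rw [AlgHom.commutes, AlgHom.commutes, Algebra.algebraMap_eq_smul_one]

lemma blockToeplitz_apply_self (l : I → ℕ) (S : I → B →ₐ[k] PowerSeries k) (b : B) (i : I)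
    (m' m : Fin (l i)) : blockToeplitz l S b ⟨i, m'⟩ ⟨i, m⟩ = toeplitz (l i) (S i b) m' m :=
  Matrix.blockDiagonal'_apply_eq (fun i => toeplitz (l i) (S i b)) i m' m

lemma blockToeplitz_apply_ne (l : I → ℕ) (S : I → B →ₐ[k] PowerSeries k) (b : B) {i j : I}
    (h : i ≠ j) (m' : Fin (l i)) (m : Fin (l j)) : blockToeplitz l S b ⟨i, m'⟩ ⟨j, m⟩ = 0 :=
  Matrix.blockDiagonal'_apply_ne (fun i => toeplitz (l i) (S i b)) m' m h

lemma sigma_fin_eq_iff {l : I → ℕ} {i j : I} {m' : Fin (l i)} {m : Fin (l j)} :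
    (⟨i, m'⟩ : Σ i, Fin (l i)) = ⟨j, m⟩ ↔ i = j ∧ (m' : ℕ) = m := by
  constructor
  · intro h
    obtain rfl : i = j := congrArg Sigma.fst h
    exact ⟨rfl, congrArg Fin.val (eq_of_heq (Sigma.mk.inj h).2)⟩
  · rintro ⟨rfl, h⟩
    rw [Fin.ext h]

/-- The extension by zero of a matrix indexed by `Σ i, Fin (l i)` to all natural numbers. -/
def extendZero {l : I → ℕ} (G : (Σ i, Fin (l i)) → (Σ i, Fin (l i)) → H) (i : I) (m' : ℕ) (j : I)
    (m : ℕ) : H :=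
  if h : m' < l i ∧ m < l j then G ⟨i, m', h.1⟩ ⟨j, m, h.2⟩ else 0

lemma extendZero_fin {l : I → ℕ} (G : (Σ i, Fin (l i)) → (Σ i, Fin (l i)) → H) (i j : I)
    (m' : Fin (l i)) (m : Fin (l j)) : extendZero G i m' j m = G ⟨i, m'⟩ ⟨j, m⟩ :=
  dif_pos ⟨m'.2, m.2⟩

lemma extendZero_of_le_left {l : I → ℕ} (G : (Σ i, Fin (l i)) → (Σ i, Fin (l i)) → H) (i j : I)
    {m' : ℕ} (m : ℕ) (h : l i ≤ m') : extendZero G i m' j m = 0 :=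
  dif_neg fun h' => by omega

lemma extendZero_of_le_right {l : I → ℕ} (G : (Σ i, Fin (l i)) → (Σ i, Fin (l i)) → H) (i j : I)
    (m' : ℕ) {m : ℕ} (h : l j ≤ m) : extendZero G i m' j m = 0 :=
  dif_neg fun h' => by omega

lemma sum_blockToeplitz_left {l : I → ℕ} (S : I → B →ₐ[k] PowerSeries k) (b : B)
    (G : (Σ i, Fin (l i)) → (Σ i, Fin (l i)) → H) (i j : I) (m' : Fin (l i)) (m : Fin (l j)) :
    ∑ c, blockToeplitz l S b ⟨i, m'⟩ c • G c ⟨j, m⟩ =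
      ∑ d ∈ Finset.range (m' + 1), PowerSeries.coeff d (S i b) • extendZero G i (m' - d) j m := by
  rw [Fintype.sum_sigma, Finset.sum_eq_single i _ (by simp)]
  · simp only [blockToeplitz_apply_self, ← extendZero_fin]
    exact sum_toeplitz_left (l i) (S i b) (fun n => extendZero G i n j m) m'
  · intro c _ hc
    refine Finset.sum_eq_zero fun n _ => ?_
    rw [blockToeplitz_apply_ne l S b hc.symm, zero_smul]

lemma sum_blockToeplitz_right {l : I → ℕ} (S : I → B →ₐ[k] PowerSeries k) (b : B)
    (G : (Σ i, Fin (l i)) → (Σ i, Fin (l i)) → H) (i j : I) (m' : Fin (l i)) (m : Fin (l j)) :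
    ∑ c, blockToeplitz l S b c ⟨j, m⟩ • G ⟨i, m'⟩ c =
      ∑ e ∈ Finset.range (l j - m),
        PowerSeries.coeff e (S j b) • extendZero G i m' j (m + e) := by
  rw [Fintype.sum_sigma, Finset.sum_eq_single j _ (by simp)]
  · simp only [blockToeplitz_apply_self, ← extendZero_fin]
    exact sum_toeplitz_right (l j) (S j b) (fun n => extendZero G i m' j n) m
  · intro c _ hc
    refine Finset.sum_eq_zero fun n _ => ?_
    rw [blockToeplitz_apply_ne l S b hc, zero_smul]

end Toeplitz

/-! ### Intertwiners of Jordan blocks -/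

section Intertwiner

variable {k : Type*} [Field k] {H : Type*} [AddCommGroup H] [Module k H] {l' l : ℕ}
  {G : ℕ → ℕ → H}

/-- There are no non-zero intertwiners between spaces on which an element acts by different
scalars. -/
lemma eq_zero_of_intertwine_const {c' c : k} (hc : c' ≠ c)
    (h1 : ∀ m' m, l' ≤ m' ∨ l ≤ m → G m' m = 0)
    (h : ∀ m' m, m' < l' → m < l →
      ∑ d ∈ Finset.range (m' + 1),
          PowerSeries.coeff d (PowerSeries.C c' : PowerSeries k) • G (m' - d) m =
        ∑ e ∈ Finset.range (l - m),
          PowerSeries.coeff e (PowerSeries.C c : PowerSeries k) • G m' (m + e)) (m' m : ℕ) :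
    G m' m = 0 := by
  by_cases hm : l' ≤ m' ∨ l ≤ m
  · exact h1 m' m hm
  · have h2 := h m' m (by omega) (by omega)
    rw [Finset.sum_eq_single_of_mem 0 (Finset.mem_range.2 (by omega)),
      Finset.sum_eq_single_of_mem 0 (Finset.mem_range.2 (by omega))] at h2
    · simp only [PowerSeries.coeff_zero_C, Nat.sub_zero, Nat.add_zero] at h2
      rw [← sub_eq_zero, ← sub_smul, smul_eq_zero] at h2
      exact h2.resolve_left (sub_ne_zero.2 hc)
    · intro e _ he
      rw [PowerSeries.coeff_C, if_neg he, zero_smul]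
    · intro e _ he
      rw [PowerSeries.coeff_C, if_neg he, zero_smul]

lemma sum_range_coeff_C_add_X (c : k) (F : ℕ → H) (N : ℕ) :
    ∑ d ∈ Finset.range (N + 2),
      PowerSeries.coeff d (PowerSeries.C c + PowerSeries.X : PowerSeries k) • F d =
        c • F 0 + F 1 := by
  rw [Finset.sum_range_succ', Finset.sum_range_succ', Finset.sum_eq_zero]
  · simp [add_comm]
  · intro d _
    simp [PowerSeries.coeff_X]

variable {c' c : k} (h1 : ∀ m' m, l' ≤ m' ∨ l ≤ m → G m' m = 0)
    (h : ∀ m' m, m' < l' → m < l →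
      ∑ d ∈ Finset.range (m' + 1),
          PowerSeries.coeff d (PowerSeries.C c' + PowerSeries.X : PowerSeries k) • G (m' - d) m =
        ∑ e ∈ Finset.range (l - m),
          PowerSeries.coeff e (PowerSeries.C c + PowerSeries.X : PowerSeries k) • G m' (m + e))
include h1 h

lemma intertwine_succ {m' m : ℕ} (hm' : m' + 1 < l') (hm : m < l) :
    c' • G (m' + 1) m + G m' m = c • G (m' + 1) m + G (m' + 1) (m + 1) := by
  have h2 := h (m' + 1) m hm' hm
  rw [sum_range_coeff_C_add_X c' (fun d => G (m' + 1 - d) m)] at h2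
  simp only [Nat.sub_zero, Nat.add_sub_cancel] at h2
  rw [h2]
  obtain ⟨N, hN⟩ : ∃ N, l - m = N + 1 := ⟨l - m - 1, by omega⟩
  have h3 := sum_range_coeff_C_add_X c (fun e => G (m' + 1) (m + e)) N
  rw [Finset.sum_range_succ, h1 (m' + 1) (m + (N + 1)) (Or.inr (by omega)), smul_zero,
    add_zero] at h3
  rw [hN, h3, add_zero]

lemma intertwine_zero {m : ℕ} (hl' : 0 < l') (hm : m < l) :
    c' • G 0 m = c • G 0 m + G 0 (m + 1) := by
  have h2 := h 0 m hl' hm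
  obtain ⟨N, hN⟩ : ∃ N, l - m = N + 1 := ⟨l - m - 1, by omega⟩
  have h3 := sum_range_coeff_C_add_X c (fun e => G 0 (m + e)) N
  rw [Finset.sum_range_succ, h1 0 (m + (N + 1)) (Or.inr (by omega)), smul_zero,
    add_zero] at h3
  rw [hN, h3] at h2
  simpa using h2

/-- Intertwiners of two Jordan blocks with different eigenvalues vanish. -/
lemma eq_zero_of_intertwine_ne (hc : c' ≠ c) (m' m : ℕ) : G m' m = 0 := by
  have key : ∀ m' d m, l ≤ m + d → G m' m = 0 := by
    intro m'
    induction m' with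
    | zero =>
      intro d
      induction d with
      | zero => exact fun m hm => h1 _ _ (Or.inr hm)
      | succ d ih =>
        intro m hm
        by_cases hlt : 0 < l' ∧ m < l
        · have h2 := intertwine_zero h1 h hlt.1 hlt.2
          rw [ih (m + 1) (by omega), add_zero, ← sub_eq_zero, ← sub_smul, smul_eq_zero] at h2
          exact h2.resolve_left (sub_ne_zero.2 hc)
        · exact h1 _ _ (by omega)
    | succ m' ih' =>
      intro d
      induction d with
      | zero => exact fun m hm => h1 _ _ (Or.inr hm)
      | succ d ih =>
        intro m hm
        by_cases hlt : m' + 1 < l' ∧ m < l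
        · have h2 := intertwine_succ h1 h hlt.1 hlt.2
          rw [ih (m + 1) (by omega), add_zero, ih' (d + 1) m hm, add_zero, ← sub_eq_zero,
            ← sub_smul, smul_eq_zero] at h2
          exact h2.resolve_left (sub_ne_zero.2 hc)
        · exact h1 _ _ (by omega)
  exact key m' l m (by omega)

/-- An intertwiner of two Jordan blocks is constant along diagonals. -/
lemma intertwine_shift {m' m : ℕ} (hc : c' = c) (hm' : m' + 1 < l') (hm : m < l) :
    G (m' + 1) (m + 1) = G m' m := by
  have h2 := intertwine_succ h1 h hm' hm
  rw [hc] at h2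
  exact (add_left_cancel h2).symm

/-- The non-zero entries of an intertwiner of Jordan blocks of sizes `l` and `l'` lie on or below
the main diagonal, and at least `l' - l` places below it. -/
lemma eq_zero_of_intertwine {m' m : ℕ} (hm : m' < m ∨ l + m' < l' + m) : G m' m = 0 := by
  by_cases hc : c' = c
  · rcases hm with hm | hm
    · have key : ∀ m' m, m' < m → G m' m = 0 := by
        intro m'
        induction m' with
        | zero =>
          intro m hm
          obtain ⟨m, rfl⟩ := Nat.exists_eq_succ_of_ne_zero hm.ne'
          by_cases hlt : 0 < l' ∧ m < l
          · have h2 := intertwine_zero h1 h hlt.1 hlt.2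
            rw [hc] at h2
            exact left_eq_add.1 h2
          · exact h1 _ _ (by omega)
        | succ m' ih =>
          intro m hm
          obtain ⟨m, rfl⟩ := Nat.exists_eq_succ_of_ne_zero (show m ≠ 0 by omega)
          by_cases hlt : m' + 1 < l' ∧ m < l
          · rw [Nat.succ_eq_add_one, intertwine_shift h1 h hc hlt.1 hlt.2, ih m (by omega)]
          · exact h1 _ _ (by omega)
      exact key m' m hm
    · have key : ∀ d m' m, l ≤ m + d → l + m' < l' + m → G m' m = 0 := by
        intro d
        induction d with
        | zero => exact fun m' m hm _ => h1 _ _ (Or.inr hm)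
        | succ d ih =>
          intro m' m hd hm
          by_cases hlt : m < l
          · rw [← intertwine_shift h1 h hc (by omega) hlt]
            exact ih _ _ (by omega) (by omega)
          · exact h1 _ _ (by omega)
      exact key l m' m (by omega) hm
  · exact eq_zero_of_intertwine_ne h1 h hc m' m

end Intertwiner

end LayeredBocs

namespace LayeredBocs

/-! ### Values of morphisms at the reflector -/

section LayerFacts

variable {k Γ Ω : Type u} [Field k] [Ring Γ] [Algebra k Γ] [AddCommGroup Ω] [Module k Ω]
  [Module Γ Ω] [Module Γᵐᵒᵖ Ω] [SMulCommClass Γ Γᵐᵒᵖ Ω] [IsScalarTower k Γ Ω]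
  [IsScalarTower k Γᵐᵒᵖ Ω] {A : Bocs k Γ Ω} (L : Layer A)

namespace Layer

lemma ω_eq_smul (b : ∀ P, L.B P) : L.ω b = L.incl b • L.ω 1 := by
  rw [← L.ω_mul, mul_one]

lemma ω_eq_op_smul (b : ∀ P, L.B P) : L.ω b = op (L.incl b) • L.ω 1 := by
  rw [← L.ω_mul_op, one_mul]

lemma bimodHom_ω_incl {M N : FDMod k Γ} (φ : bimodHom Ω M N) (b : ∀ P, L.B P) (m : M.carrier) :
    φ.1 (L.ω 1) (L.incl b • m) = L.incl b • φ.1 (L.ω 1) m := by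
  rw [← φ.2.2, ← L.ω_eq_op_smul, L.ω_eq_smul, φ.2.1]

lemma bimodHom_δ {M N : FDMod k Γ} (φ : bimodHom Ω M N) (γ : Γ) (m : M.carrier) :
    φ.1 (L.δ γ) m = γ • φ.1 (L.ω 1) m - φ.1 (L.ω 1) (γ • m) := by
  rw [Layer.δ, map_sub, LinearMap.sub_apply, φ.2.1, φ.2.2]

lemma evalFunctorial : A.EvalFunctorial (L.ω 1) where
  counit_eq := by rw [L.counit_ω, map_one]
  compHom_apply {M N E} φ ψ := by
    have h1 : L.ω 1 = ∑ P, L.ω (Pi.single P 1) := by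
      rw [← map_sum, ← Finset.univ_sum_single (1 : ∀ P, L.B P)]
      rfl
    refine LinearMap.ext fun m => ?_
    change pairing φ ψ (A.comul (L.ω 1)) m = ψ.1 (L.ω 1) (φ.1 (L.ω 1) m)
    have h2 : ∀ P, pairing φ ψ (A.comul (L.ω (Pi.single P 1))) m =
        ψ.1 (L.ω (Pi.single P 1)) (φ.1 (L.ω 1) m) := by
      intro P
      have h3 : φ.1 (L.ω (Pi.single P 1)) m = L.incl (Pi.single P 1) • φ.1 (L.ω 1) m := by
        rw [L.ω_eq_smul, φ.2.1]
      rw [L.comul_ω, pairing_bal₂, LinearMap.comp_apply, h3, ← ψ.2.2, ← L.ω_mul_op,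
        ← Pi.single_mul, mul_one]
    generalize φ.1 (L.ω 1) m = y at h2 ⊢
    rw [h1, map_sum, map_sum, LinearMap.sum_apply, Finset.sum_congr rfl fun P _ => h2 P,
      map_sum, LinearMap.sum_apply]

lemma bimodHom_coeffMul {M N : FDMod k Γ} (φ : bimodHom Ω M N) {P Q : Fin L.vertices}
    (x : L.B P) (y : L.B Q) (w : Ω) (m : M.carrier) :
    φ.1 (L.coeffMul P Q (x ⊗ₜ y) w) m =
      L.incl (Pi.single Q y) • φ.1 w (L.incl (Pi.single P x) • m) := by
  have h : L.coeffMul P Q (x ⊗ₜ y) w =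
      L.incl (Pi.single Q y) • op (L.incl (Pi.single P x)) • w := by
    rw [Layer.coeffMul, TensorProduct.map_tmul, TensorProduct.comm_tmul, sandwich,
      TensorProduct.lift.tmul]
    rfl
  rw [h, φ.2.1, φ.2.2]

lemma coeffMul_add {P Q : Fin L.vertices} (f g : L.B P ⊗[k] L.B Q) (w : Ω) :
    L.coeffMul P Q (f + g) w = L.coeffMul P Q f w + L.coeffMul P Q g w := by
  simp only [Layer.coeffMul, map_add, LinearMap.add_apply]

lemma coeffMul_zero {P Q : Fin L.vertices} (w : Ω) : L.coeffMul P Q 0 w = 0 := by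
  simp only [Layer.coeffMul, map_zero, LinearMap.zero_apply]

end Layer

lemma entry_lsmul {R : Type u} [Ring R] [Algebra k R] {n : ℕ}
    (ρ : Γ →ₐ[k] Matrix (Fin n) (Fin n) R) (M : FDMod k R) (γ : Γ) (a b : Fin n) :
    entry (ι := Fin n) (V := M.carrier) (W := M.carrier)
        (Algebra.lsmul k k (tensorObj ρ M).carrier γ) a b =
      Algebra.lsmul k k M.carrier (ρ γ a b) := by
  refine LinearMap.ext fun x => ?_
  change ∑ c, ρ γ a c • (Pi.single b x : Fin n → M.carrier) c = ρ γ a b • x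
  rw [Finset.sum_eq_single b]
  · rw [Pi.single_eq_same]
  · intro c _ hc
    rw [Pi.single_eq_of_ne hc, smul_zero]
  · simp

end LayerFacts

/-! ### Representations made of Jordan blocks and one arrow -/

/-- The coefficient of `λ ^ e * μ ^ d` in the image of an element of `B ⊗ C` under a pair of
expansions in power series `B → k⟦λ⟧` and `C → k⟦μ⟧`. -/
noncomputable def taylorCoeff {k B C : Type*} [Field k] [CommRing B] [Algebra k B] [CommRing C]
    [Algebra k C] (σ : B →ₐ[k] PowerSeries k) (τ : C →ₐ[k] PowerSeries k) (e d : ℕ) :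
    B ⊗[k] C →ₗ[k] k :=
  LinearMap.mul' k k ∘ₗ
    TensorProduct.map (PowerSeries.coeff e ∘ₗ σ.toLinearMap) (PowerSeries.coeff d ∘ₗ τ.toLinearMap)

lemma taylorCoeff_tmul {k B C : Type*} [Field k] [CommRing B] [Algebra k B] [CommRing C]
    [Algebra k C] (σ : B →ₐ[k] PowerSeries k) (τ : C →ₐ[k] PowerSeries k) (e d : ℕ) (x : B)
    (y : C) :
    taylorCoeff σ τ e d (x ⊗ₜ y) = PowerSeries.coeff e (σ x) * PowerSeries.coeff d (τ y) := by
  simp [taylorCoeff]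

/-- Building blocks of a bimodule `T` supported at the source and the target of the first solid
arrow, whose endomorphism algebras are `B` and `C`. The source carries the `B`-module
`⨁ᵢ k⟦X⟧ / (X ^ lenS i)` with `B` acting through `actS i`, the target similarly, and the arrow is a
sum of `r` matrix units with coefficients `val t` in `k⟨x,y⟩`: the `t`-th one goes from the
coordinate `X ^ srcP t` of the block `srcB t` to the coordinate `X ^ tgtP t` of the block
`tgtB t`. -/
structure BlockDatum (k B C : Type u) [Field k] [CommRing B] [Algebra k B] [CommRing C]
    [Algebra k C] (p q r : ℕ) where
  lenS : Fin p → ℕ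
  lenT : Fin q → ℕ
  actS : Fin p → B →ₐ[k] PowerSeries k
  actT : Fin q → C →ₐ[k] PowerSeries k
  srcB : Fin r → Fin p
  srcP : Fin r → ℕ
  srcP_lt : ∀ t, srcP t < lenS (srcB t)
  tgtB : Fin r → Fin q
  tgtP : Fin r → ℕ
  tgtP_lt : ∀ t, tgtP t < lenT (tgtB t)
  val : Fin r → FreeAlgebra k (Fin 2)

namespace BlockDatum

section

variable {k B C : Type u} [Field k] [CommRing B] [Algebra k B] [CommRing C] [Algebra k C]
  {p q r : ℕ} (D : BlockDatum k B C p q r)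

/-- The sizes of all blocks, those at the source and those at the target. -/
def len : Fin p ⊕ Fin q → ℕ := Sum.elim D.lenS D.lenT

/-- The coordinates of the bimodule `T`. -/
abbrev Coord : Type := Σ i, Fin (D.len i)

/-- The source of the `t`-th matrix unit. -/
def srcC (t : Fin r) : D.Coord := ⟨Sum.inl (D.srcB t), D.srcP t, D.srcP_lt t⟩

/-- The target of the `t`-th matrix unit. -/
def tgtC (t : Fin r) : D.Coord := ⟨Sum.inr (D.tgtB t), D.tgtP t, D.tgtP_lt t⟩

/-- The matrix of the arrow. -/
def arrowMatrix : Matrix D.Coord D.Coord (FreeAlgebra k (Fin 2)) :=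
  ∑ t, Matrix.single (D.tgtC t) (D.srcC t) (D.val t)

variable {H : Type*} [AddCommGroup H] [Module k H]

/-- The contribution of the arrow to the commutation relation of a morphism `E` (given by a matrix
over `H`, on which `k⟨x,y⟩` acts on the left through `lact` and on the right through `ract`): the
entry, from position `m` of the block `j` at the source to position `m'` of the block `i` at the
target, of the difference of the composites of `E` with the arrow. -/
def arrowDefect (lact ract : FreeAlgebra k (Fin 2) → H → H)
    (E : Fin p ⊕ Fin q → ℕ → Fin p ⊕ Fin q → ℕ → H)
    (i : Fin q) (m' : ℕ) (j : Fin p) (m : ℕ) : H :=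
  (∑ t, if D.tgtB t = i ∧ D.tgtP t = m' then
      lact (D.val t) (E (Sum.inl (D.srcB t)) (D.srcP t) (Sum.inl j) m) else 0) -
    ∑ t, if D.srcB t = j ∧ D.srcP t = m then
      ract (D.val t) (E (Sum.inr i) m' (Sum.inr (D.tgtB t)) (D.tgtP t)) else 0

end

section

variable {k Γ Ω : Type u} [Field k] [Ring Γ] [Algebra k Γ] [AddCommGroup Ω] [Module k Ω]
  [Module Γ Ω] [Module Γᵐᵒᵖ Ω] [SMulCommClass Γ Γᵐᵒᵖ Ω] [IsScalarTower k Γ Ω]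
  [IsScalarTower k Γᵐᵒᵖ Ω] {A : Bocs k Γ Ω} {L : Layer A} {P Q : Fin L.vertices}
  {p q r : ℕ} (D : BlockDatum k (L.B P) (L.B Q) p q r)

/-- The action of `Γ'` on each block. -/
noncomputable def act : Fin p ⊕ Fin q → (∀ P, L.B P) →ₐ[k] PowerSeries k :=
  Sum.elim (fun i => (D.actS i).comp (Pi.evalAlgHom k L.B P))
    (fun i => (D.actT i).comp (Pi.evalAlgHom k L.B Q))

lemma exists_rep (hn : 0 < L.n) (hP : L.src ⟨0, hn⟩ = P) (hQ : L.tgt ⟨0, hn⟩ = Q) :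
    ∃ ρ : Γ →ₐ[k] Matrix D.Coord D.Coord (FreeAlgebra k (Fin 2)),
      (∀ b, ρ (L.incl b) = (blockToeplitz D.len D.act b).map (algebraMap k _)) ∧
        ρ (L.a ⟨0, hn⟩) = D.arrowMatrix := by
  have hcol : ∀ (b : ∀ P, L.B P) (c : D.Coord) (j) (m : Fin (D.len j)), D.act j b = 1 →
      blockToeplitz D.len D.act b c ⟨j, m⟩ = (1 : Matrix D.Coord D.Coord k) c ⟨j, m⟩ := by
    rintro b ⟨i, m'⟩ j m hb
    by_cases hij : i = j
    · subst hij
      rw [blockToeplitz_apply_self, hb, ← toeplitzHom_apply, map_one, Matrix.one_apply,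
        Matrix.one_apply]
      simp
    · rw [blockToeplitz_apply_ne _ _ _ hij, Matrix.one_apply_ne]
      exact fun h => hij (congrArg Sigma.fst h)
  have hrow : ∀ (b : ∀ P, L.B P) (c : D.Coord) (j) (m : Fin (D.len j)), D.act j b = 1 →
      blockToeplitz D.len D.act b ⟨j, m⟩ c = (1 : Matrix D.Coord D.Coord k) ⟨j, m⟩ c := by
    rintro b ⟨i, m'⟩ j m hb
    by_cases hij : j = i
    · subst hij
      rw [blockToeplitz_apply_self, hb, ← toeplitzHom_apply, map_one, Matrix.one_apply,
        Matrix.one_apply]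
      simp
    · rw [blockToeplitz_apply_ne _ _ _ hij, Matrix.one_apply_ne]
      exact fun h => hij (congrArg Sigma.fst h)
  let h : (∀ P, L.B P) →ₐ[k] Matrix D.Coord D.Coord (FreeAlgebra k (Fin 2)) :=
    (Algebra.ofId k (FreeAlgebra k (Fin 2))).mapMatrix.comp (blockToeplitz D.len D.act)
  have hh : ∀ b, h b = (blockToeplitz D.len D.act b).map (algebraMap k _) := fun b => rfl
  have hQ1 : h (Pi.single Q 1) * D.arrowMatrix = D.arrowMatrix := by
    rw [arrowMatrix, Finset.mul_sum]
    refine Finset.sum_congr rfl fun t _ => ?_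
    ext c d
    rw [hh, Matrix.mul_apply, Finset.sum_eq_single (D.tgtC t) _ (by simp), Matrix.map_apply, tgtC,
      hcol _ _ _ _ (by simp [act]), Matrix.one_apply, Matrix.single_apply, Matrix.single_apply]
    · by_cases hc : c = ⟨Sum.inr (D.tgtB t), D.tgtP t, D.tgtP_lt t⟩
      · simp [hc]
      · simp [hc, Ne.symm hc]
    · intro e _ he
      rw [Matrix.single_apply, if_neg (fun h => he h.1.symm), mul_zero]
  have hP1 : D.arrowMatrix * h (Pi.single P 1) = D.arrowMatrix := by
    rw [arrowMatrix, Finset.sum_mul]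
    refine Finset.sum_congr rfl fun t _ => ?_
    ext c d
    rw [hh, Matrix.mul_apply, Finset.sum_eq_single (D.srcC t) _ (by simp), Matrix.map_apply, srcC,
      hrow _ _ _ _ (by simp [act]), Matrix.one_apply, Matrix.single_apply, Matrix.single_apply]
    · by_cases hc : ⟨Sum.inl (D.srcB t), D.srcP t, D.srcP_lt t⟩ = d
      · simp [hc]
      · simp [hc]
    · intro e _ he
      rw [Matrix.single_apply, if_neg (fun h => he h.2.symm), zero_mul]
  obtain ⟨ρ, ⟨hρ1, hρ2⟩, -⟩ := L.free _ h (fun i => if i = ⟨0, hn⟩ then D.arrowMatrix else 0)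
    (fun i => by
      split_ifs with hi
      · rw [hi, hP, hQ, hQ1, hP1]
      · rw [mul_zero, zero_mul])
  refine ⟨ρ, fun b => ?_, ?_⟩
  · rw [← hh, ← hρ1]
    rfl
  · rw [hρ2, if_pos rfl]

end

end BlockDatum

end LayeredBocs

namespace LayeredBocs

/-! ### Morphisms between representations given by a block datum -/

namespace BlockDatum

section

variable {k Γ Ω : Type u} [Field k] [Ring Γ] [Algebra k Γ] [AddCommGroup Ω] [Module k Ω]
  [Module Γ Ω] [Module Γᵐᵒᵖ Ω] [SMulCommClass Γ Γᵐᵒᵖ Ω] [IsScalarTower k Γ Ω]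
  [IsScalarTower k Γᵐᵒᵖ Ω] {A : Bocs k Γ Ω} {L : Layer A} {P Q : Fin L.vertices}
  {p q r : ℕ} (D : BlockDatum k (L.B P) (L.B Q) p q r)

/-- The conditions satisfied by the matrix `E` (over a `k`-module `H` with left and right actions
`lact` and `ract` of `k⟨x,y⟩`) of the value at the reflector of a morphism between representations
`T ⊗ L`: it commutes with `Γ'`, and its commutator with the first solid arrow is `f s` for some
matrix `s`, if the differential of the arrow is `f v`. -/
structure IsMorphismMatrix {H : Type*} [AddCommGroup H] [Module k H]
    (lact ract : FreeAlgebra k (Fin 2) → H → H) (f : L.B P ⊗[k] L.B Q)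
    (E : Fin p ⊕ Fin q → ℕ → Fin p ⊕ Fin q → ℕ → H) : Prop where
  eq_zero : ∀ i j m' m, D.len i ≤ m' ∨ D.len j ≤ m → E i m' j m = 0
  intertwine : ∀ (b : ∀ P, L.B P) (i j) (m' m), m' < D.len i → m < D.len j →
    ∑ d ∈ Finset.range (m' + 1), PowerSeries.coeff d (D.act i b) • E i (m' - d) j m =
      ∑ e ∈ Finset.range (D.len j - m), PowerSeries.coeff e (D.act j b) • E i m' j (m + e)
  arrow : ∃ s : Fin q → ℕ → Fin p → ℕ → H, ∀ i j m' m, m' < D.lenT i → m < D.lenS j →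
    D.arrowDefect lact ract E i m' j m =
      ∑ d ∈ Finset.range (m' + 1), ∑ e ∈ Finset.range (D.lenS j - m),
        taylorCoeff (D.actS j) (D.actT i) e d f • s i (m' - d) j (m + e)

/-- A block datum yields wildness if all morphism matrices are, for some grading `deg` of the
coordinates, strictly triangular up to a constant `k⟨x,y⟩`-linear diagonal. -/
theorem isWildOfRank (hn : 0 < L.n) (hP : L.src ⟨0, hn⟩ = P) (hQ : L.tgt ⟨0, hn⟩ = Q)
    (f : L.B P ⊗[k] L.B Q) (v : Ω) (hδ : L.δ (L.a ⟨0, hn⟩) = L.coeffMul P Q f v)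
    (deg : Fin p ⊕ Fin q → ℕ → ℕ) {n : ℕ} (hn0 : 0 < n) (hcard : ∑ i, D.len i = n)
    (H : ∀ (M N : FDMod k (FreeAlgebra k (Fin 2)))
      (E : Fin p ⊕ Fin q → ℕ → Fin p ⊕ Fin q → ℕ → M.carrier →ₗ[k] N.carrier),
      D.IsMorphismMatrix (fun r h => Algebra.lsmul k k N.carrier r ∘ₗ h)
        (fun r h => h ∘ₗ Algebra.lsmul k k M.carrier r) f E →
      ∃ θ : M.carrier →ₗ[FreeAlgebra k (Fin 2)] N.carrier,
        (∀ i m, m < D.len i → E i m i m = θ.restrictScalars k) ∧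
        ∀ i j m' m, (i, m') ≠ (j, m) → deg i m' ≤ deg j m → E i m' j m = 0) :
    A.IsWildOfRank n := by
  obtain ⟨ρ', hρ1, hρ2⟩ := D.exists_rep hn hP hQ
  let e : D.Coord ≃ Fin n := Fintype.equivFinOfCardEq (by simp [hcard])
  let ρ : Γ →ₐ[k] Matrix (Fin n) (Fin n) (FreeAlgebra k (Fin 2)) :=
    (Matrix.reindexAlgEquiv k (FreeAlgebra k (Fin 2)) e).toAlgHom.comp ρ'
  have hρ : ∀ γ a b, ρ γ (e a) (e b) = ρ' γ a b := by
    intro γ a b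
    change ρ' γ (e.symm (e a)) (e.symm (e b)) = _
    rw [e.symm_apply_apply, e.symm_apply_apply]
  refine L.evalFunctorial.isWildOfRank hn0 ρ (fun a => deg (e.symm a).1 (e.symm a).2)
    fun M N φ => ?_
  let ent : ((tensorObj ρ M).carrier →ₗ[k] (tensorObj ρ N).carrier) → D.Coord → D.Coord →
      M.carrier →ₗ[k] N.carrier := fun Φ a b =>
    entry (ι := Fin n) (V := M.carrier) (W := N.carrier) Φ (e a) (e b)
  let G : Ω → D.Coord → D.Coord → M.carrier →ₗ[k] N.carrier := fun w =>
    ent ((show bimodHom Ω (tensorObj ρ M) (tensorObj ρ N) from φ).1 w)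
  have hG : ∀ a b, evalEntry (L.ω 1) φ a b = G (L.ω 1) (e.symm a) (e.symm b) := by
    intro a b
    simp only [G, ent, e.apply_symm_apply]
    rfl
  -- The actions of `Γ` on the two sides, in terms of entries.
  have hleft : ∀ (γ : Γ) (Φ : (tensorObj ρ M).carrier →ₗ[k] (tensorObj ρ N).carrier)
      (a b : D.Coord),
      entry (ι := Fin n) (V := M.carrier) (W := N.carrier)
        (Algebra.lsmul k k (tensorObj ρ N).carrier γ ∘ₗ Φ) (e a) (e b) =
      ∑ c, Algebra.lsmul k k N.carrier (ρ' γ a c) ∘ₗ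
        entry (ι := Fin n) (V := M.carrier) (W := N.carrier) Φ (e c) (e b) := by
    intro γ Φ a b
    refine (entry_comp (ι := Fin n) (V := M.carrier) (W := N.carrier) (U := N.carrier)
      (Algebra.lsmul k k (tensorObj ρ N).carrier γ) Φ (e a) (e b)).trans ?_
    rw [← e.sum_comp]
    simp only [entry_lsmul, hρ]
  have hright : ∀ (γ : Γ) (Φ : (tensorObj ρ M).carrier →ₗ[k] (tensorObj ρ N).carrier)
      (a b : D.Coord),
      entry (ι := Fin n) (V := M.carrier) (W := N.carrier)
        (Φ ∘ₗ Algebra.lsmul k k (tensorObj ρ M).carrier γ) (e a) (e b) =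
      ∑ c, entry (ι := Fin n) (V := M.carrier) (W := N.carrier) Φ (e a) (e c) ∘ₗ
        Algebra.lsmul k k M.carrier (ρ' γ c b) := by
    intro γ Φ a b
    refine (entry_comp (ι := Fin n) (V := M.carrier) (W := M.carrier) (U := N.carrier)
      Φ (Algebra.lsmul k k (tensorObj ρ M).carrier γ) (e a) (e b)).trans ?_
    rw [← e.sum_comp]
    simp only [entry_lsmul, hρ]
  have hscalL : ∀ (c : k) (h : M.carrier →ₗ[k] N.carrier),
      Algebra.lsmul k k N.carrier (algebraMap k (FreeAlgebra k (Fin 2)) c) ∘ₗ h = c • h := by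
    intro c h
    refine LinearMap.ext fun x => ?_
    exact algebraMap_smul _ c (h x)
  have hscalR : ∀ (c : k) (h : M.carrier →ₗ[k] N.carrier),
      h ∘ₗ Algebra.lsmul k k M.carrier (algebraMap k (FreeAlgebra k (Fin 2)) c) = c • h := by
    intro c h
    refine LinearMap.ext fun x => ?_
    exact (congrArg h (algebraMap_smul _ c x)).trans (map_smul h c x)
  have hinclL : ∀ (b : ∀ P, L.B P) (Φ : (tensorObj ρ M).carrier →ₗ[k] (tensorObj ρ N).carrier)
      (i j m' m), m' < D.len i → m < D.len j →
      extendZero (ent (Algebra.lsmul k k (tensorObj ρ N).carrier (L.incl b) ∘ₗ Φ)) i m' j m =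
      ∑ d ∈ Finset.range (m' + 1), PowerSeries.coeff d (D.act i b) •
        extendZero (ent Φ) i (m' - d) j m := by
    intro b Φ i j m' m hm' hm
    refine (extendZero_fin (ent _) i j ⟨m', hm'⟩ ⟨m, hm⟩).trans ?_
    refine (hleft (L.incl b) Φ ⟨i, m', hm'⟩ ⟨j, m, hm⟩).trans ?_
    rw [← sum_blockToeplitz_left D.act b (ent Φ) i j ⟨m', hm'⟩ ⟨m, hm⟩]
    simp only [hρ1, Matrix.map_apply, hscalL, ent]
  have hinclR : ∀ (b : ∀ P, L.B P) (Φ : (tensorObj ρ M).carrier →ₗ[k] (tensorObj ρ N).carrier)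
      (i j m' m), m' < D.len i → m < D.len j →
      extendZero (ent (Φ ∘ₗ Algebra.lsmul k k (tensorObj ρ M).carrier (L.incl b))) i m' j m =
      ∑ c ∈ Finset.range (D.len j - m), PowerSeries.coeff c (D.act j b) •
        extendZero (ent Φ) i m' j (m + c) := by
    intro b Φ i j m' m hm' hm
    refine (extendZero_fin (ent _) i j ⟨m', hm'⟩ ⟨m, hm⟩).trans ?_
    refine (hright (L.incl b) Φ ⟨i, m', hm'⟩ ⟨j, m, hm⟩).trans ?_
    rw [← sum_blockToeplitz_right D.act b (ent Φ) i j ⟨m', hm'⟩ ⟨m, hm⟩]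
    simp only [hρ1, Matrix.map_apply, hscalR, ent]
  have hdefect : ∀ i j (m' : Fin (D.lenT i)) (m : Fin (D.lenS j)),
      G (L.δ (L.a ⟨0, hn⟩)) ⟨Sum.inr i, m'⟩ ⟨Sum.inl j, m⟩ =
        D.arrowDefect (fun r h => Algebra.lsmul k k N.carrier r ∘ₗ h)
          (fun r h => h ∘ₗ Algebra.lsmul k k M.carrier r) (extendZero (G (L.ω 1))) i m' j m := by
    intro i j m' m
    have h1 : (show bimodHom Ω (tensorObj ρ M) (tensorObj ρ N) from φ).1 (L.δ (L.a ⟨0, hn⟩)) =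
        Algebra.lsmul k k (tensorObj ρ N).carrier (L.a ⟨0, hn⟩) ∘ₗ
            (show bimodHom Ω (tensorObj ρ M) (tensorObj ρ N) from φ).1 (L.ω 1) -
          (show bimodHom Ω (tensorObj ρ M) (tensorObj ρ N) from φ).1 (L.ω 1) ∘ₗ
            Algebra.lsmul k k (tensorObj ρ M).carrier (L.a ⟨0, hn⟩) :=
      LinearMap.ext fun x => L.bimodHom_δ
        (show bimodHom Ω (tensorObj ρ M) (tensorObj ρ N) from φ) _ x
    have hT : ∀ t, D.tgtC t = ⟨Sum.inr i, m'⟩ ↔ D.tgtB t = i ∧ D.tgtP t = m' := fun t =>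
      sigma_fin_eq_iff.trans (by rw [Sum.inr.injEq])
    have hS : ∀ t, D.srcC t = ⟨Sum.inl j, m⟩ ↔ D.srcB t = j ∧ D.srcP t = m := fun t =>
      sigma_fin_eq_iff.trans (by rw [Sum.inl.injEq])
    have hGL : ∀ t, extendZero (G (L.ω 1)) (Sum.inl (D.srcB t)) (D.srcP t) (Sum.inl j) m =
        G (L.ω 1) (D.srcC t) ⟨Sum.inl j, m⟩ := fun t =>
      extendZero_fin (l := D.len) _ (Sum.inl (D.srcB t)) (Sum.inl j) ⟨D.srcP t, D.srcP_lt t⟩ m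
    have hGR : ∀ t, extendZero (G (L.ω 1)) (Sum.inr i) m' (Sum.inr (D.tgtB t)) (D.tgtP t) =
        G (L.ω 1) ⟨Sum.inr i, m'⟩ (D.tgtC t) := fun t =>
      extendZero_fin (l := D.len) _ (Sum.inr i) (Sum.inr (D.tgtB t)) m' ⟨D.tgtP t, D.tgtP_lt t⟩
    have h2 : ∀ a b : D.Coord, G (L.δ (L.a ⟨0, hn⟩)) a b =
        ∑ c, Algebra.lsmul k k N.carrier (D.arrowMatrix a c) ∘ₗ G (L.ω 1) c b -
          ∑ c, G (L.ω 1) a c ∘ₗ Algebra.lsmul k k M.carrier (D.arrowMatrix c b) := by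
      intro a b
      rw [← hρ2]
      refine Eq.trans ?_ (congrArg₂ (· - ·) (hleft _ _ a b) (hright _ _ a b))
      simp only [G, ent]
      rw [h1]
      rfl
    have hsumL : ∀ (F : Fin r → N.carrier →ₗ[k] N.carrier) (h : M.carrier →ₗ[k] N.carrier),
        (∑ t, F t) ∘ₗ h = ∑ t, F t ∘ₗ h := fun F h => by
      ext x
      simp [LinearMap.sum_apply]
    have hsumR : ∀ (F : Fin r → M.carrier →ₗ[k] M.carrier) (h : M.carrier →ₗ[k] N.carrier),
        h ∘ₗ (∑ t, F t) = ∑ t, h ∘ₗ F t := fun F h => by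
      ext x
      simp [LinearMap.sum_apply]
    rw [h2, arrowDefect]
    simp only [hGL, hGR, ← hT, ← hS, arrowMatrix, Matrix.sum_apply, map_sum]
    congr 1
    · simp only [hsumL]
      rw [Finset.sum_comm]
      refine Finset.sum_congr rfl fun t _ => ?_
      rw [Finset.sum_eq_single (D.srcC t) _ (by simp)]
      · rw [Matrix.single_apply]
        split_ifs with h3 h4 h4
        · rfl
        · exact absurd h3.1 h4
        · exact absurd ⟨h4, rfl⟩ h3
        · rw [map_zero, LinearMap.zero_comp]
      · intro c _ hc
        rw [Matrix.single_apply, if_neg (fun h => hc h.2.symm), map_zero, LinearMap.zero_comp]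
    · simp only [hsumR]
      rw [Finset.sum_comm]
      refine Finset.sum_congr rfl fun t _ => ?_
      rw [Finset.sum_eq_single (D.tgtC t) _ (by simp)]
      · rw [Matrix.single_apply]
        split_ifs with h3 h4 h4
        · rfl
        · exact absurd h3.2 h4
        · exact absurd ⟨rfl, h4⟩ h3
        · rw [map_zero, LinearMap.comp_zero]
      · intro c _ hc
        rw [Matrix.single_apply, if_neg (fun h => hc h.1.symm), map_zero, LinearMap.comp_zero]
  have htaylor : ∀ (g : L.B P ⊗[k] L.B Q) i j (m' : Fin (D.lenT i)) (m : Fin (D.lenS j)),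
      G (L.coeffMul P Q g v) ⟨Sum.inr i, m'⟩ ⟨Sum.inl j, m⟩ =
        ∑ d ∈ Finset.range (m' + 1), ∑ c ∈ Finset.range (D.lenS j - m),
          taylorCoeff (D.actS j) (D.actT i) c d g •
            extendZero (G v) (Sum.inr i) (m' - d) (Sum.inl j) (m + c) := by
    intro g i j m' m
    have hG0 : ∀ w a b, w = 0 → G w a b = 0 := by
      intro w a b hw
      simp only [G, ent, hw, map_zero]
      rfl
    have hGadd : ∀ w w' a b, G (w + w') a b = G w a b + G w' a b := by
      intro w w' a b
      simp only [G, ent, map_add]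
      rfl
    induction g with
    | zero =>
      rw [hG0 _ _ _ (L.coeffMul_zero v)]
      simp
    | add g g' hg hg' =>
      rw [L.coeffMul_add, hGadd, hg, hg']
      simp only [map_add, add_smul, Finset.sum_add_distrib]
    | tmul x y =>
      have h1 : (show bimodHom Ω (tensorObj ρ M) (tensorObj ρ N) from φ).1
          (L.coeffMul P Q (x ⊗ₜ y) v) =
          Algebra.lsmul k k (tensorObj ρ N).carrier (L.incl (Pi.single Q y)) ∘ₗ
            ((show bimodHom Ω (tensorObj ρ M) (tensorObj ρ N) from φ).1 v ∘ₗ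
              Algebra.lsmul k k (tensorObj ρ M).carrier (L.incl (Pi.single P x))) :=
        LinearMap.ext fun z => L.bimodHom_coeffMul
          (show bimodHom Ω (tensorObj ρ M) (tensorObj ρ N) from φ) x y v z
      rw [← extendZero_fin (l := D.len) (G _) (Sum.inr i) (Sum.inl j) m' m]
      simp only [G]
      rw [h1]
      refine (hinclL _ _ (Sum.inr i) (Sum.inl j) m' m m'.2 m.2).trans ?_
      refine Finset.sum_congr rfl fun d _ => ?_
      rw [hinclR _ _ (Sum.inr i) (Sum.inl j) (m' - d) m (lt_of_le_of_lt (Nat.sub_le _ _) m'.2) m.2]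
      rw [Finset.smul_sum]
      refine Finset.sum_congr rfl fun c _ => ?_
      rw [smul_smul, taylorCoeff_tmul, mul_comm]
      simp [act]
  obtain ⟨θ, hθ1, hθ2⟩ := H M N (extendZero (G (L.ω 1)))
    { eq_zero := fun i j m' m h => h.elim (fun h => extendZero_of_le_left _ i j m h)
        (fun h => extendZero_of_le_right _ i j m' h)
      intertwine := by
        intro b i j m' m hm' hm
        have h1 := hinclL b ((show bimodHom Ω (tensorObj ρ M) (tensorObj ρ N) from φ).1 (L.ω 1))
          i j m' m hm' hm
        have h2 := hinclR b ((show bimodHom Ω (tensorObj ρ M) (tensorObj ρ N) from φ).1 (L.ω 1))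
          i j m' m hm' hm
        refine h1.symm.trans (Eq.trans ?_ h2)
        congr 2
        exact LinearMap.ext fun x => (L.bimodHom_ω_incl
          (show bimodHom Ω (tensorObj ρ M) (tensorObj ρ N) from φ) b x).symm
      arrow := by
        refine ⟨fun i m' j m => extendZero (G v) (Sum.inr i) m' (Sum.inl j) m,
          fun i j m' m hm' hm => ?_⟩
        have h1 := hdefect i j ⟨m', hm'⟩ ⟨m, hm⟩
        rw [hδ, htaylor f i j ⟨m', hm'⟩ ⟨m, hm⟩] at h1
        exact h1.symm }
  refine ⟨θ, fun a => ?_, fun a b hab h => ?_⟩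
  · rw [hG, ← hθ1 (e.symm a).1 (e.symm a).2 (e.symm a).2.2, extendZero_fin]
  · rw [hG, ← hθ2 (e.symm a).1 (e.symm b).1 (e.symm a).2 (e.symm b).2 _ h, extendZero_fin]
    intro h'
    have h3 := (Prod.mk.inj h').1
    have h4 := (Prod.mk.inj h').2
    refine hab (e.symm.injective ?_)
    generalize e.symm a = a' at *
    generalize e.symm b = b' at *
    obtain ⟨i, m'⟩ := a'
    obtain ⟨j, m⟩ := b'
    obtain rfl : i = j := h3
    obtain rfl : m' = m := Fin.ext h4
    rfl

end

end BlockDatum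

end LayeredBocs

namespace LayeredBocs

/-! ### Wildness from Jordan blocks of different sizes -/

/-- A linear map commuting with the two generators is linear over the free algebra. -/
lemma exists_linearMap_of_commute_generators {k : Type*} [Field k] {V W : Type*} [AddCommGroup V]
    [AddCommGroup W] [Module k V] [Module k W] [Module (FreeAlgebra k (Fin 2)) V]
    [Module (FreeAlgebra k (Fin 2)) W] [IsScalarTower k (FreeAlgebra k (Fin 2)) V]
    [IsScalarTower k (FreeAlgebra k (Fin 2)) W] (θ : V →ₗ[k] W)
    (h : ∀ i : Fin 2, Algebra.lsmul k k W (FreeAlgebra.ι k i) ∘ₗ θ =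
      θ ∘ₗ Algebra.lsmul k k V (FreeAlgebra.ι k i)) :
    ∃ θ' : V →ₗ[FreeAlgebra k (Fin 2)] W, θ'.restrictScalars k = θ := by
  have key : ∀ (a : FreeAlgebra k (Fin 2)) (x : V), θ (a • x) = a • θ x := by
    intro a
    induction a using FreeAlgebra.induction with
    | grade0 c => intro x; rw [algebraMap_smul, algebraMap_smul, map_smul]
    | grade1 i => exact fun x => (LinearMap.congr_fun (h i) x).symm
    | mul a b ha hb => intro x; rw [mul_smul, mul_smul, ha, hb]
    | add a b ha hb => intro x; rw [add_smul, add_smul, map_add, ha, hb]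
  exact ⟨{ toFun := θ, map_add' := map_add θ, map_smul' := key }, rfl⟩

namespace BlockDatum

section

variable {k Γ Ω : Type u} [Field k] [Ring Γ] [Algebra k Γ] [AddCommGroup Ω] [Module k Ω]
  [Module Γ Ω] [Module Γᵐᵒᵖ Ω] [SMulCommClass Γ Γᵐᵒᵖ Ω] [IsScalarTower k Γ Ω]
  [IsScalarTower k Γᵐᵒᵖ Ω] {A : Bocs k Γ Ω} {L : Layer A} {P Q : Fin L.vertices} {p q r : ℕ}
  (D : BlockDatum k (L.B P) (L.B Q) p q r)

/-- The vanishing and constancy of matrix entries that hold for intertwiners of Jordan blocks. -/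
structure IsJordanMatrix {H : Type*} [AddCommGroup H] [Module k H]
    (E : Fin p ⊕ Fin q → ℕ → Fin p ⊕ Fin q → ℕ → H) : Prop where
  eq_zero : ∀ i j m' m, m' < m ∨ D.len j + m' < D.len i + m → E i m' j m = 0
  diagonal : ∀ i m, m < D.len i → E i m i m = E i 0 i 0
  shift : ∀ i j, D.act i = D.act j → ∀ m' m, m' + 1 < D.len i → m < D.len j →
    E i (m' + 1) j (m + 1) = E i m' j m

/-- Some element of `Γ'` acts on every block by a Jordan matrix. -/
def IsJordan : Prop :=
  ∃ b : ∀ P, L.B P, ∀ i, ∃ c : k, D.act i b = PowerSeries.C c + PowerSeries.X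

variable {D}

/-- Blocks separated by an element of `Γ'` acting by different constants have no intertwiners. -/
lemma IsMorphismMatrix.eq_zero_of_act_eq_const {H : Type*} [AddCommGroup H] [Module k H]
    {lact ract : FreeAlgebra k (Fin 2) → H → H} {f : L.B P ⊗[k] L.B Q}
    {E : Fin p ⊕ Fin q → ℕ → Fin p ⊕ Fin q → ℕ → H} (hE : D.IsMorphismMatrix lact ract f E)
    {i j : Fin p ⊕ Fin q} (b : ∀ P, L.B P) {c' c : k} (hc : c' ≠ c)
    (hi : D.act i b = PowerSeries.C c') (hj : D.act j b = PowerSeries.C c) (m' m : ℕ) :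
    E i m' j m = 0 := by
  have hb := hE.intertwine b i j
  rw [hi, hj] at hb
  exact eq_zero_of_intertwine_const (G := fun m' m => E i m' j m) hc (hE.eq_zero i j) hb m' m

lemma IsMorphismMatrix.isJordanMatrix (hD : D.IsJordan) {H : Type*} [AddCommGroup H] [Module k H]
    {lact ract : FreeAlgebra k (Fin 2) → H → H} {f : L.B P ⊗[k] L.B Q}
    {E : Fin p ⊕ Fin q → ℕ → Fin p ⊕ Fin q → ℕ → H} (hE : D.IsMorphismMatrix lact ract f E) :
    D.IsJordanMatrix E where
  eq_zero i j m' m h := by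
    obtain ⟨b, hb⟩ := hD
    obtain ⟨c', h1⟩ := hb i
    obtain ⟨c, h2⟩ := hb j
    have hb := hE.intertwine b i j
    rw [h1, h2] at hb
    exact eq_zero_of_intertwine (G := fun m' m => E i m' j m) (hE.eq_zero i j) hb h
  diagonal i m hm := by
    obtain ⟨b, hb⟩ := hD
    obtain ⟨c, h1⟩ := hb i
    have hb := hE.intertwine b i i
    rw [h1] at hb
    induction m with
    | zero => rfl
    | succ m ih =>
      rw [← ih (by omega)]
      exact intertwine_shift (G := fun m' m => E i m' i m) (hE.eq_zero i i) hb rfl hm (by omega)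
  shift i j hij m' m hm' hm := by
    obtain ⟨b, hb⟩ := hD
    obtain ⟨c, h1⟩ := hb i
    have hb := hE.intertwine b i j
    rw [← hij, h1] at hb
    exact intertwine_shift (G := fun m' m => E i m' j m) (hE.eq_zero i j) hb rfl hm' hm

variable (D) in
/-- Blocks of size one yield wildness as soon as all morphism matrices are diagonal, with constant
`k⟨x,y⟩`-linear diagonal. -/
theorem isWildOfRank_of_len_eq_one (hn : 0 < L.n) (hP : L.src ⟨0, hn⟩ = P)
    (hQ : L.tgt ⟨0, hn⟩ = Q) (f : L.B P ⊗[k] L.B Q) (v : Ω)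
    (hδ : L.δ (L.a ⟨0, hn⟩) = L.coeffMul P Q f v) (hlen : ∀ i, D.len i = 1) (hpq : 0 < p + q)
    (H : ∀ (M N : FDMod k (FreeAlgebra k (Fin 2)))
      (E : Fin p ⊕ Fin q → ℕ → Fin p ⊕ Fin q → ℕ → M.carrier →ₗ[k] N.carrier),
      D.IsMorphismMatrix (fun r h => Algebra.lsmul k k N.carrier r ∘ₗ h)
        (fun r h => h ∘ₗ Algebra.lsmul k k M.carrier r) f E →
      (∃ θ : M.carrier →ₗ[k] N.carrier, (∀ i, E i 0 i 0 = θ) ∧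
        ∀ t : Fin 2, Algebra.lsmul k k N.carrier (FreeAlgebra.ι k t) ∘ₗ θ =
          θ ∘ₗ Algebra.lsmul k k M.carrier (FreeAlgebra.ι k t)) ∧
      ∀ i j, i ≠ j → E i 0 j 0 = 0) :
    A.IsWildOfRank (p + q) := by
  refine D.isWildOfRank hn hP hQ f v hδ (fun _ _ => 0) hpq (by simp [hlen]) fun M N E hE => ?_
  obtain ⟨⟨θ, hθ, hθR⟩, hoff⟩ := H M N E hE
  obtain ⟨θ', hθ'⟩ := exists_linearMap_of_commute_generators θ hθR
  refine ⟨θ', fun i m hm => ?_, fun i j m' m hne _ => ?_⟩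
  · rw [hlen, Nat.lt_one_iff] at hm
    rw [hm, hθ, hθ']
  · by_cases h : m' = 0 ∧ m = 0
    · obtain ⟨rfl, rfl⟩ := h
      exact hoff i j fun hij => hne (by rw [hij])
    · exact hE.eq_zero i j m' m (by rw [hlen, hlen]; omega)

/-- Jordan blocks of pairwise different sizes yield wildness as soon as the commutation relation for
the arrow forces all leading diagonal entries to be equal and `k⟨x,y⟩`-linear: the coordinate
`X ^ m` of a block of size `l` has degree `2 m - l`, up to a constant. -/
theorem isWildOfRank_of_isJordan (hn : 0 < L.n) (hP : L.src ⟨0, hn⟩ = P) (hQ : L.tgt ⟨0, hn⟩ = Q)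
    (f : L.B P ⊗[k] L.B Q) (v : Ω) (hδ : L.δ (L.a ⟨0, hn⟩) = L.coeffMul P Q f v)
    (hD : D.IsJordan) (hlen : Function.Injective D.len) {n : ℕ} (hn0 : 0 < n)
    (hcard : ∑ i, D.len i = n)
    (H : ∀ (M N : FDMod k (FreeAlgebra k (Fin 2)))
      (E : Fin p ⊕ Fin q → ℕ → Fin p ⊕ Fin q → ℕ → M.carrier →ₗ[k] N.carrier),
      D.IsMorphismMatrix (fun r h => Algebra.lsmul k k N.carrier r ∘ₗ h)
        (fun r h => h ∘ₗ Algebra.lsmul k k M.carrier r) f E → D.IsJordanMatrix E →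
      ∃ θ : M.carrier →ₗ[k] N.carrier, (∀ i, E i 0 i 0 = θ) ∧
        ∀ t : Fin 2, Algebra.lsmul k k N.carrier (FreeAlgebra.ι k t) ∘ₗ θ =
          θ ∘ₗ Algebra.lsmul k k M.carrier (FreeAlgebra.ι k t)) :
    A.IsWildOfRank n := by
  refine D.isWildOfRank hn hP hQ f v hδ (fun i m => 2 * m + (n - D.len i)) hn0 hcard
    fun M N E hE => ?_
  have hJ := hE.isJordanMatrix hD
  obtain ⟨θ, hθ, hθR⟩ := H M N E hE hJ
  obtain ⟨θ', hθ'⟩ := exists_linearMap_of_commute_generators θ hθR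
  refine ⟨θ', fun i m hm => ?_, fun i j m' m hne hdeg => ?_⟩
  · rw [hJ.diagonal i m hm, hθ, hθ']
  · have hle : ∀ i, D.len i ≤ n := fun i =>
      hcard ▸ Finset.single_le_sum (f := D.len) (fun _ _ => Nat.zero_le _) (Finset.mem_univ i)
    apply hJ.eq_zero
    by_contra hcon
    have h1 := hle i
    have h2 := hle j
    by_cases hij : i = j
    · subst hij
      exact hne (by rw [show m' = m by omega])
    · have h3 : D.len i ≠ D.len j := fun h => hij (hlen h)
      omega

end

end BlockDatum

end LayeredBocs

namespace LayeredBocs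

/-! ### Functionals vanishing on the multiples of a power series -/

section Taylor

variable {k : Type*} [Field k] {H : Type*} [AddCommGroup H] [Module k H]

/-- If `f = ∑ f e d λᵉ μᵈ` has no constant term and a non-zero linear term in `λ`, then there is
`h = h₁ μ + h₂ μ² + h₃ μ³` with `f(h(μ), μ) = O(μ⁴)`. Substituting `λ = h(μ)` then gives functionals
vanishing on all multiples of `f`; written out on the array `u` of the coefficients of a
multiple `f g`, they are the coefficients of `μ⁰`, …, `μ³`. -/
lemma exists_functionals_of_coeff_ne_zero {f : ℕ → ℕ → k} (h00 : f 0 0 = 0) (h10 : f 1 0 ≠ 0) :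
    ∃ h₁ h₂ h₃ : k, ∀ (w : ℕ) (g u : ℕ → ℕ → H),
      (∀ b a, b + a ≤ w → u b a = ∑ d ∈ Finset.range (b + 1), ∑ e ∈ Finset.range (a + 1),
        f e d • g (b - d) (a - e)) →
      u 0 0 = 0 ∧ (1 ≤ w → u 1 0 + h₁ • u 0 1 = 0) ∧
      (2 ≤ w → u 2 0 + h₁ • u 1 1 + h₂ • u 0 1 + h₁ ^ 2 • u 0 2 = 0) ∧
      (3 ≤ w → u 3 0 + h₁ • u 2 1 + h₂ • u 1 1 + h₃ • u 0 1 + h₁ ^ 2 • u 1 2 +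
        (2 * h₁ * h₂) • u 0 2 + h₁ ^ 3 • u 0 3 = 0) := by
  obtain ⟨h₁, E1⟩ : ∃ h₁, f 0 1 + h₁ * f 1 0 = 0 := ⟨-(f 0 1) / f 1 0, by field_simp; ring⟩
  obtain ⟨h₂, E2⟩ : ∃ h₂, f 0 2 + h₁ * f 1 1 + h₁ ^ 2 * f 2 0 + h₂ * f 1 0 = 0 :=
    ⟨-(f 0 2 + h₁ * f 1 1 + h₁ ^ 2 * f 2 0) / f 1 0, by field_simp; ring⟩
  obtain ⟨h₃, E3⟩ : ∃ h₃, f 0 3 + h₁ * f 1 2 + h₂ * f 1 1 + h₁ ^ 2 * f 2 1 +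
      2 * h₁ * h₂ * f 2 0 + h₁ ^ 3 * f 3 0 + h₃ * f 1 0 = 0 :=
    ⟨-(f 0 3 + h₁ * f 1 2 + h₂ * f 1 1 + h₁ ^ 2 * f 2 1 +
      2 * h₁ * h₂ * f 2 0 + h₁ ^ 3 * f 3 0) / f 1 0, by field_simp; ring⟩
  refine ⟨h₁, h₂, h₃, fun w g u hu => ⟨?_, fun hw => ?_, fun hw => ?_, fun hw => ?_⟩⟩
  · rw [hu 0 0 (by omega)]
    simp [h00]
  · rw [hu 1 0 (by omega), hu 0 1 (by omega)]
    simp only [Finset.sum_range_succ, Finset.sum_range_zero, h00, zero_smul, zero_add]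
    norm_num
    linear_combination (norm := module) E1 • g 0 0
  · rw [hu 2 0 (by omega), hu 1 1 (by omega), hu 0 1 (by omega), hu 0 2 (by omega)]
    simp only [Finset.sum_range_succ, Finset.sum_range_zero, h00, zero_smul, zero_add]
    norm_num
    linear_combination (norm := module) E2 • g 0 0 + E1 • g 1 0 + h₁ • E1 • g 0 1
  · rw [hu 3 0 (by omega), hu 2 1 (by omega), hu 1 1 (by omega), hu 0 1 (by omega),
      hu 1 2 (by omega), hu 0 2 (by omega), hu 0 3 (by omega)]
    simp only [Finset.sum_range_succ, Finset.sum_range_zero, h00, zero_smul, zero_add]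
    norm_num
    linear_combination (norm := module) E3 • g 0 0 + E2 • g 1 0 + E1 • g 2 0 +
      h₁ • E2 • g 0 1 + h₂ • E1 • g 0 1 + h₁ • E1 • g 1 1 + h₁ ^ 2 • E1 • g 0 2

end Taylor

end LayeredBocs

namespace LayeredBocs

/-! ### Block data at a zero of the coefficient of the differential -/

namespace BlockDatum

/-- A unital map `k⟨x,y⟩ → (H → H)` preserving `0`: all that is used about the actions of `k⟨x,y⟩`
on matrix entries. -/
structure IsUnitalAction {k : Type*} [Field k] {H : Type*} [AddCommGroup H]
    (act : FreeAlgebra k (Fin 2) → H → H) : Prop where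
  one_act : ∀ h, act 1 h = h
  act_zero : ∀ a, act a 0 = 0

section

variable {k B C : Type u} [Field k] [CommRing B] [Algebra k B] [CommRing C] [Algebra k C]

/-- Five Jordan blocks, of sizes `3`, `5` at the source and `2`, `4`, `6` at the target. The arrow
joins the socle of the `j`-th source block to `X ^ (i + j)` in the `i`-th target block, so that it
is a representation of the complete bipartite quiver with `2 + 3` vertices. -/
noncomputable def datumTwoThree (σ : B →ₐ[k] PowerSeries k) (τ : C →ₐ[k] PowerSeries k) :
    BlockDatum k B C 2 3 6 where
  lenS := ![3, 5]
  lenT := ![2, 4, 6]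
  actS := fun _ => σ
  actT := fun _ => τ
  srcB := ![0, 0, 0, 1, 1, 1]
  srcP := ![2, 2, 2, 4, 4, 4]
  srcP_lt := by decide
  tgtB := ![0, 1, 2, 0, 1, 2]
  tgtP := ![0, 1, 2, 1, 2, 3]
  tgtP_lt := by decide
  val := ![1, 1, 1, 1, FreeAlgebra.ι k 0, FreeAlgebra.ι k 1]

/-- The dual of `datumTwoThree`: the roles of source and target are exchanged, and the coordinates
of each block are reversed. -/
noncomputable def datumThreeTwo (σ : B →ₐ[k] PowerSeries k) (τ : C →ₐ[k] PowerSeries k) :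
    BlockDatum k B C 3 2 6 where
  lenS := ![2, 4, 6]
  lenT := ![3, 5]
  actS := fun _ => σ
  actT := fun _ => τ
  srcB := ![0, 1, 2, 0, 1, 2]
  srcP := ![1, 2, 3, 0, 1, 2]
  srcP_lt := by decide
  tgtB := ![0, 0, 0, 1, 1, 1]
  tgtP := ![0, 0, 0, 0, 0, 0]
  tgtP_lt := by decide
  val := ![1, 1, 1, 1, FreeAlgebra.ι k 0, FreeAlgebra.ι k 1]

/-- Four Jordan blocks, of sizes `2`, `3` at the source and `4`, `5` at the target, for a zero of
order at least two of the coefficient. Modulo the multiples of such a coefficient, each pair of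
blocks admits two independent arrows, from `X ^ (l - 2)` to `1` and from the socle `X ^ (l - 1)` to
`X`, where `l` is the size of the source block. -/
noncomputable def datumTwoTwo (σ : B →ₐ[k] PowerSeries k) (τ : C →ₐ[k] PowerSeries k) :
    BlockDatum k B C 2 2 5 where
  lenS := ![2, 3]
  lenT := ![4, 5]
  actS := fun _ => σ
  actT := fun _ => τ
  srcB := ![0, 1, 0, 0, 1]
  srcP := ![0, 1, 0, 1, 2]
  srcP_lt := by decide
  tgtB := ![0, 0, 1, 0, 1]
  tgtP := ![0, 0, 0, 1, 1]
  tgtP_lt := by decide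
  val := ![FreeAlgebra.ι k 1, 1, 1, FreeAlgebra.ι k 0, 1]

end

section

variable {k Γ Ω : Type u} [Field k] [Ring Γ] [Algebra k Γ] [AddCommGroup Ω] [Module k Ω]
  [Module Γ Ω] [Module Γᵐᵒᵖ Ω] [SMulCommClass Γ Γᵐᵒᵖ Ω] [IsScalarTower k Γ Ω]
  [IsScalarTower k Γᵐᵒᵖ Ω] {A : Bocs k Γ Ω} {L : Layer A} {P Q : Fin L.vertices}
  {H : Type*} [AddCommGroup H] [Module k H] {lact ract : FreeAlgebra k (Fin 2) → H → H}

/-- The commutation relation for the arrow, with the coordinates of the source blocks reversed. -/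
lemma IsMorphismMatrix.exists_arrowDefect_eq {p q r : ℕ} {D : BlockDatum k (L.B P) (L.B Q) p q r}
    {f : L.B P ⊗[k] L.B Q} {E : Fin p ⊕ Fin q → ℕ → Fin p ⊕ Fin q → ℕ → H}
    (hE : D.IsMorphismMatrix lact ract f E) :
    ∃ g : Fin q → Fin p → ℕ → ℕ → H, ∀ i j b a, b < D.lenT i → a < D.lenS j →
      D.arrowDefect lact ract E i b j (D.lenS j - 1 - a) =
        ∑ d ∈ Finset.range (b + 1), ∑ e ∈ Finset.range (a + 1),
          taylorCoeff (D.actS j) (D.actT i) e d f • g i j (b - d) (a - e) := by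
  obtain ⟨s, hs⟩ := hE.arrow
  refine ⟨fun i j b a => s i b j (D.lenS j - 1 - a), fun i j b a hb ha => ?_⟩
  rw [hs i j b _ hb (by omega), show D.lenS j - (D.lenS j - 1 - a) = a + 1 by omega]
  refine Finset.sum_congr rfl fun d _ => Finset.sum_congr rfl fun e he => ?_
  have := Finset.mem_range.1 he
  rw [show D.lenS j - 1 - a + e = D.lenS j - 1 - (a - e) by omega]

variable (hl : IsUnitalAction lact) (hr : IsUnitalAction ract)
  {σ : L.B P →ₐ[k] PowerSeries k} {τ : L.B Q →ₐ[k] PowerSeries k} {f : L.B P ⊗[k] L.B Q}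
  (h00 : taylorCoeff σ τ 0 0 f = 0)
include hl hr h00

/-- If `f` has a non-zero linear term in the source variable, then the functionals vanishing on its
multiples give one equation for each of the six pairs of blocks. -/
lemma datumTwoThree_diagonal (h10 : taylorCoeff σ τ 1 0 f ≠ 0)
    {E : Fin 2 ⊕ Fin 3 → ℕ → Fin 2 ⊕ Fin 3 → ℕ → H}
    (hE : (datumTwoThree σ τ).IsMorphismMatrix lact ract f E)
    (hJ : (datumTwoThree σ τ).IsJordanMatrix E) :
    ∃ θ, (∀ i, E i 0 i 0 = θ) ∧
      ∀ t : Fin 2, lact (FreeAlgebra.ι k t) θ = ract (FreeAlgebra.ι k t) θ := by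
  obtain ⟨g, hg⟩ := hE.exists_arrowDefect_eq
  obtain ⟨h₁, h₂, h₃, hh⟩ := exists_functionals_of_coeff_ne_zero (H := H)
    (f := fun e d => taylorCoeff σ τ e d f) h00 h10
  have hw : ∀ (i : Fin 3) (j : Fin 2) (w : ℕ), w < ![2, 4, 6] i → w < ![3, 5] j → _ :=
    fun i j w hi hj => hh w (g i j)
      (fun b a => (datumTwoThree σ τ).arrowDefect lact ract E i b j (![3, 5] j - 1 - a))
      (fun b a hab => hg i j b a (show b < ![2, 4, 6] i by omega) (show a < ![3, 5] j by omega))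
  have hz : ∀ i j m' m, m' < m ∨ Sum.elim ![3, 5] ![2, 4, 6] j + m' <
    Sum.elim ![3, 5] ![2, 4, 6] i + m → E i m' j m = 0 := hJ.eq_zero
  have hs : ∀ i m, m < Sum.elim ![3, 5] ![2, 4, 6] i → E i m i m = E i 0 i 0 := hJ.diagonal
  have e00 := (hw 0 0 0 (by decide) (by decide)).1
  have e10 := (hw 1 0 1 (by decide) (by decide)).2.1 le_rfl
  have e20 := (hw 2 0 2 (by decide) (by decide)).2.2.1 le_rfl
  have e01 := (hw 0 1 1 (by decide) (by decide)).2.1 le_rfl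
  have e11 := (hw 1 1 2 (by decide) (by decide)).2.2.1 le_rfl
  have e21 := (hw 2 1 3 (by decide) (by decide)).2.2.2 le_rfl
  simp [arrowDefect, datumTwoThree, Fin.sum_univ_succ, hl.one_act, hr.one_act, hr.act_zero, hz,
    sub_eq_zero] at e00 e10 e20 e01 e11 e21
  rw [hs _ 2 (by decide)] at e00 e10 e20
  rw [hs _ 4 (by decide)] at e01 e11 e21
  rw [hs _ 1 (by decide)] at e10 e01
  rw [hs _ 2 (by decide)] at e20 e11
  rw [hs _ 3 (by decide)] at e21
  refine ⟨E (Sum.inl 0) 0 (Sum.inl 0) 0, ?_, ?_⟩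
  · rintro (i | i) <;> fin_cases i
    · rfl
    · exact e01.trans e00.symm
    · exact e00.symm
    · exact e10.symm
    · exact e20.symm
  · intro t
    rw [← e01.trans e00.symm] at e10 e20
    rw [← e01.trans e00.symm]
    fin_cases t
    · rwa [← e10] at e11
    · rwa [← e20] at e21

/-- If `f` has a non-zero linear term in the target variable, the equations are those of
`datumTwoThree_diagonal` for the transposed array of coefficients. -/
lemma datumThreeTwo_diagonal (h01 : taylorCoeff σ τ 0 1 f ≠ 0)
    {E : Fin 3 ⊕ Fin 2 → ℕ → Fin 3 ⊕ Fin 2 → ℕ → H}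
    (hE : (datumThreeTwo σ τ).IsMorphismMatrix lact ract f E)
    (hJ : (datumThreeTwo σ τ).IsJordanMatrix E) :
    ∃ θ, (∀ i, E i 0 i 0 = θ) ∧
      ∀ t : Fin 2, lact (FreeAlgebra.ι k t) θ = ract (FreeAlgebra.ι k t) θ := by
  obtain ⟨g, hg⟩ := hE.exists_arrowDefect_eq
  obtain ⟨h₁, h₂, h₃, hh⟩ := exists_functionals_of_coeff_ne_zero (H := H)
    (f := fun e d => taylorCoeff σ τ d e f) h00 h01
  have hw : ∀ (i : Fin 2) (j : Fin 3) (w : ℕ), w < ![3, 5] i → w < ![2, 4, 6] j → _ :=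
    fun i j w hi hj => hh w (fun a b => g i j b a)
      (fun a b => (datumThreeTwo σ τ).arrowDefect lact ract E i b j (![2, 4, 6] j - 1 - a))
      (fun a b hab => (hg i j b a (show b < ![3, 5] i by omega)
        (show a < ![2, 4, 6] j by omega)).trans Finset.sum_comm)
  have hz : ∀ i j m' m, m' < m ∨ Sum.elim ![2, 4, 6] ![3, 5] j + m' <
    Sum.elim ![2, 4, 6] ![3, 5] i + m → E i m' j m = 0 := hJ.eq_zero
  have hs : ∀ i m, m < Sum.elim ![2, 4, 6] ![3, 5] i → E i m i m = E i 0 i 0 := hJ.diagonal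
  have e00 := (hw 0 0 0 (by decide) (by decide)).1
  have e01 := (hw 0 1 1 (by decide) (by decide)).2.1 le_rfl
  have e02 := (hw 0 2 2 (by decide) (by decide)).2.2.1 le_rfl
  have e10 := (hw 1 0 1 (by decide) (by decide)).2.1 le_rfl
  have e11 := (hw 1 1 2 (by decide) (by decide)).2.2.1 le_rfl
  have e12 := (hw 1 2 3 (by decide) (by decide)).2.2.2 le_rfl
  simp [arrowDefect, datumThreeTwo, Fin.sum_univ_succ, hl.one_act, hr.one_act, hl.act_zero, hz,
    sub_eq_zero] at e00 e10 e01 e11 e02 e12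
  rw [hs _ 1 (by decide)] at e00
  rw [hs _ 2 (by decide)] at e01
  rw [hs _ 3 (by decide)] at e02
  rw [hs _ 1 (by decide)] at e11
  rw [hs _ 2 (by decide)] at e12
  refine ⟨E (Sum.inl 0) 0 (Sum.inl 0) 0, ?_, ?_⟩
  · rintro (i | i) <;> fin_cases i
    · rfl
    · exact e01.trans e00.symm
    · exact e02.trans e00.symm
    · exact e00.symm
    · exact e10.symm
  · intro t
    rw [e01.trans e00.symm, ← e10] at e11
    rw [e02.trans e00.symm, ← e10] at e12
    fin_cases t
    · exact e11
    · exact e12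

/-- If `f` has no linear term, then the coefficients of both linear monomials vanish on its
multiples, and two equations are available for each pair of blocks. -/
lemma datumTwoTwo_diagonal (h10 : taylorCoeff σ τ 1 0 f = 0) (h01 : taylorCoeff σ τ 0 1 f = 0)
    {E : Fin 2 ⊕ Fin 2 → ℕ → Fin 2 ⊕ Fin 2 → ℕ → H}
    (hE : (datumTwoTwo σ τ).IsMorphismMatrix lact ract f E)
    (hJ : (datumTwoTwo σ τ).IsJordanMatrix E) :
    ∃ θ, (∀ i, E i 0 i 0 = θ) ∧
      ∀ t : Fin 2, lact (FreeAlgebra.ι k t) θ = ract (FreeAlgebra.ι k t) θ := by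
  obtain ⟨g, hg⟩ := hE.exists_arrowDefect_eq
  have h1 : ∀ i j, (datumTwoTwo σ τ).arrowDefect lact ract E i 0 j (![2, 3] j - 1 - 1) = 0 := by
    intro i j
    refine (hg i j 0 1 (show 0 < ![4, 5] i by fin_cases i <;> decide)
      (show 1 < ![2, 3] j by fin_cases j <;> decide)).trans ?_
    change ∑ d ∈ Finset.range 1, ∑ e ∈ Finset.range 2, taylorCoeff σ τ e d f • _ = 0
    simp [Finset.sum_range_succ, h00, h10]
  have h2 : ∀ i j, (datumTwoTwo σ τ).arrowDefect lact ract E i 1 j (![2, 3] j - 1 - 0) = 0 := by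
    intro i j
    refine (hg i j 1 0 (show 1 < ![4, 5] i by fin_cases i <;> decide)
      (show 0 < ![2, 3] j by fin_cases j <;> decide)).trans ?_
    change ∑ d ∈ Finset.range 2, ∑ e ∈ Finset.range 1, taylorCoeff σ τ e d f • _ = 0
    simp [Finset.sum_range_succ, h00, h01]
  have hz : ∀ i j m' m, m' < m ∨ Sum.elim ![2, 3] ![4, 5] j + m' <
    Sum.elim ![2, 3] ![4, 5] i + m → E i m' j m = 0 := hJ.eq_zero
  have hs : ∀ i m, m < Sum.elim ![2, 3] ![4, 5] i → E i m i m = E i 0 i 0 := hJ.diagonal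
  have q00 := h1 0 0
  have q01 := h1 0 1
  have q10 := h1 1 0
  have r00 := h2 0 0
  have r01 := h2 0 1
  have r10 := h2 1 0
  have r11 := h2 1 1
  simp [arrowDefect, datumTwoTwo, Fin.sum_univ_succ, hl.one_act, hr.one_act, hl.act_zero,
    hr.act_zero, hz, sub_eq_zero] at q00 q01 q10 r00 r01 r10 r11
  -- The two off-diagonal entries in `q00` reappear, shifted, as the only terms of `r10` and `r01`.
  have s1 : E (Sum.inl 1) 2 (Sum.inl 0) 1 = E (Sum.inl 1) 1 (Sum.inl 0) 0 :=
    hJ.shift (Sum.inl 1) (Sum.inl 0) rfl 1 0 (show 2 < 3 by decide) (show 0 < 2 by decide)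
  have s2 : E (Sum.inr 0) 1 (Sum.inr 1) 1 = E (Sum.inr 0) 0 (Sum.inr 1) 0 :=
    hJ.shift (Sum.inr 0) (Sum.inr 1) rfl 0 0 (show 1 < 4 by decide) (show 0 < 5 by decide)
  rw [hs _ 1 (by decide)] at q01
  rw [hs _ 1 (by decide), hs _ 1 (by decide)] at r00
  rw [hs _ 2 (by decide), hs _ 1 (by decide)] at r11
  rw [s1] at r10
  rw [s2] at r01
  rw [r10, r01, add_zero, add_zero] at q00
  have t1 := q10.trans (r11.symm.trans q01)
  rw [← t1] at q00 r00
  refine ⟨E (Sum.inl 0) 0 (Sum.inl 0) 0, ?_, ?_⟩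
  · rintro (i | i) <;> fin_cases i
    · rfl
    · exact q01.trans t1.symm
    · exact t1.symm
    · exact q10.symm
  · intro t
    fin_cases t
    · exact r00
    · exact q00

end

end BlockDatum

end LayeredBocs

namespace LayeredBocs

/-! ### Block data at a vanishing differential -/

namespace BlockDatum

section

variable {k B C : Type u} [Field k] [CommRing B] [Algebra k B] [CommRing C] [Algebra k C]

/-- A five-subspace representation for an arrow whose source carries a parameter: five eigenspaces
at the source, for the characters `χ`, are mapped into the two-dimensional space at the target with
images spanned by `(1, 0)`, `(0, 1)`, `(1, 1)`, `(1, x)` and `(1, y)`. -/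
noncomputable def datumStar (χ : Fin 5 → B →ₐ[k] k) (ψ : C →ₐ[k] k) : BlockDatum k B C 5 2 8 where
  lenS := fun _ => 1
  lenT := fun _ => 1
  actS := fun i => (Algebra.ofId k (PowerSeries k)).comp (χ i)
  actT := fun _ => (Algebra.ofId k (PowerSeries k)).comp ψ
  srcB := ![0, 1, 2, 2, 3, 3, 4, 4]
  srcP := fun _ => 0
  srcP_lt := fun _ => one_pos
  tgtB := ![0, 1, 0, 1, 0, 1, 0, 1]
  tgtP := fun _ => 0
  tgtP_lt := fun _ => one_pos
  val := ![1, 1, 1, 1, 1, FreeAlgebra.ι k 0, 1, FreeAlgebra.ι k 1]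

/-- The dual of `datumStar`: five functionals on the two-dimensional space at the source, with
values in five eigenspaces at the target. -/
noncomputable def datumCostar (χ : B →ₐ[k] k) (ψ : Fin 5 → C →ₐ[k] k) :
    BlockDatum k B C 2 5 8 where
  lenS := fun _ => 1
  lenT := fun _ => 1
  actS := fun _ => (Algebra.ofId k (PowerSeries k)).comp χ
  actT := fun i => (Algebra.ofId k (PowerSeries k)).comp (ψ i)
  srcB := ![0, 1, 0, 1, 0, 1, 0, 1]
  srcP := fun _ => 0
  srcP_lt := fun _ => one_pos
  tgtB := ![0, 1, 2, 2, 3, 3, 4, 4]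
  tgtP := fun _ => 0
  tgtP_lt := fun _ => one_pos
  val := ![1, 1, 1, 1, 1, FreeAlgebra.ι k 0, 1, FreeAlgebra.ι k 1]

end

section

variable {k Γ Ω : Type u} [Field k] [Ring Γ] [Algebra k Γ] [AddCommGroup Ω] [Module k Ω]
  [Module Γ Ω] [Module Γᵐᵒᵖ Ω] [SMulCommClass Γ Γᵐᵒᵖ Ω] [IsScalarTower k Γ Ω]
  [IsScalarTower k Γᵐᵒᵖ Ω] {A : Bocs k Γ Ω} {L : Layer A} {P Q : Fin L.vertices}
  {H : Type*} [AddCommGroup H] [Module k H] {lact ract : FreeAlgebra k (Fin 2) → H → H}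

/-- If the differential of the arrow vanishes then so does the commutator. -/
lemma IsMorphismMatrix.arrowDefect_eq_zero {p q r : ℕ} {D : BlockDatum k (L.B P) (L.B Q) p q r}
    {E : Fin p ⊕ Fin q → ℕ → Fin p ⊕ Fin q → ℕ → H} (hE : D.IsMorphismMatrix lact ract 0 E)
    {i j} {m' m : ℕ} (hi : m' < D.lenT i) (hj : m < D.lenS j) :
    D.arrowDefect lact ract E i m' j m = 0 := by
  obtain ⟨s, hs⟩ := hE.arrow
  rw [hs i j m' m hi hj]
  simp

variable (hl : IsUnitalAction lact) (hr : IsUnitalAction ract) (hPQ : P ≠ Q)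
include hl hr hPQ

lemma datumStar_diagonal {χ : Fin 5 → L.B P →ₐ[k] k} {ψ : L.B Q →ₐ[k] k} {l : L.B P}
    (hχ : Function.Injective fun i => χ i l) {E : Fin 5 ⊕ Fin 2 → ℕ → Fin 5 ⊕ Fin 2 → ℕ → H}
    (hE : (datumStar χ ψ).IsMorphismMatrix lact ract 0 E) :
    (∃ θ, (∀ i, E i 0 i 0 = θ) ∧
      ∀ t : Fin 2, lact (FreeAlgebra.ι k t) θ = ract (FreeAlgebra.ι k t) θ) ∧
    ∀ i j, i ≠ j → E i 0 j 0 = 0 := by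
  have hS : ∀ i j, i ≠ j → E (Sum.inl i) 0 (Sum.inl j) 0 = 0 := fun i j hij =>
    hE.eq_zero_of_act_eq_const (Pi.single P l) (c' := χ i l) (c := χ j l) (fun h => hij (hχ h))
      (by simp [act, datumStar, Algebra.ofId_apply])
      (by simp [act, datumStar, Algebra.ofId_apply]) 0 0
  have hST : ∀ i j, E (Sum.inl i) 0 (Sum.inr j) 0 = 0 := fun i j =>
    hE.eq_zero_of_act_eq_const (Pi.single P 1) (c' := 1) (c := 0) one_ne_zero
      (by simp [act]) (by simp [act, Pi.single_eq_of_ne hPQ.symm]) 0 0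
  have hTS : ∀ i j, E (Sum.inr i) 0 (Sum.inl j) 0 = 0 := fun i j =>
    hE.eq_zero_of_act_eq_const (Pi.single P 1) (c' := 0) (c := 1) zero_ne_one
      (by simp [act, Pi.single_eq_of_ne hPQ.symm]) (by simp [act]) 0 0
  have hd : ∀ i j, (datumStar χ ψ).arrowDefect lact ract E i 0 j 0 = 0 := fun i j =>
    hE.arrowDefect_eq_zero one_pos one_pos
  -- The first two subspaces force the matrix at the target to be diagonal.
  have d10 := hd 1 0
  have d01 := hd 0 1
  simp [arrowDefect, datumStar, Fin.sum_univ_succ, hl.one_act, hr.one_act, hl.act_zero, hS]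
    at d10 d01
  have d00 := hd 0 0
  have d11 := hd 1 1
  have d02 := hd 0 2
  have d12 := hd 1 2
  have d03 := hd 0 3
  have d13 := hd 1 3
  have d04 := hd 0 4
  have d14 := hd 1 4
  simp [arrowDefect, datumStar, Fin.sum_univ_succ, hl.one_act, hr.one_act, hl.act_zero,
    hr.act_zero, hS, d10, d01, sub_eq_zero] at d00 d11 d02 d12 d03 d13 d04 d14
  have e11 := d02.symm.trans d12
  refine ⟨⟨E (Sum.inr 0) 0 (Sum.inr 0) 0, ?_, fun t => ?_⟩, ?_⟩
  · rintro (i | i) <;> fin_cases i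
    exacts [d00, d11.trans e11.symm, d02, d03, d04, rfl, e11.symm]
  · rw [d03, ← e11] at d13
    rw [d04, ← e11] at d14
    fin_cases t
    exacts [d13, d14]
  · rintro (i | i) (j | j) hij
    · exact hS i j fun h => hij (congrArg _ h)
    · exact hST i j
    · exact hTS i j
    · fin_cases i <;> fin_cases j
      exacts [absurd rfl hij, d01, d10, absurd rfl hij]

lemma datumCostar_diagonal {χ : L.B P →ₐ[k] k} {ψ : Fin 5 → L.B Q →ₐ[k] k} {l : L.B Q}
    (hψ : Function.Injective fun i => ψ i l) {E : Fin 2 ⊕ Fin 5 → ℕ → Fin 2 ⊕ Fin 5 → ℕ → H}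
    (hE : (datumCostar χ ψ).IsMorphismMatrix lact ract 0 E) :
    (∃ θ, (∀ i, E i 0 i 0 = θ) ∧
      ∀ t : Fin 2, lact (FreeAlgebra.ι k t) θ = ract (FreeAlgebra.ι k t) θ) ∧
    ∀ i j, i ≠ j → E i 0 j 0 = 0 := by
  have hT : ∀ i j, i ≠ j → E (Sum.inr i) 0 (Sum.inr j) 0 = 0 := fun i j hij =>
    hE.eq_zero_of_act_eq_const (Pi.single Q l) (c' := ψ i l) (c := ψ j l) (fun h => hij (hψ h))
      (by simp [act, datumCostar, Algebra.ofId_apply])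
      (by simp [act, datumCostar, Algebra.ofId_apply]) 0 0
  have hST : ∀ i j, E (Sum.inl i) 0 (Sum.inr j) 0 = 0 := fun i j =>
    hE.eq_zero_of_act_eq_const (Pi.single P 1) (c' := 1) (c := 0) one_ne_zero
      (by simp [act]) (by simp [act, Pi.single_eq_of_ne hPQ.symm]) 0 0
  have hTS : ∀ i j, E (Sum.inr i) 0 (Sum.inl j) 0 = 0 := fun i j =>
    hE.eq_zero_of_act_eq_const (Pi.single P 1) (c' := 0) (c := 1) zero_ne_one
      (by simp [act, Pi.single_eq_of_ne hPQ.symm]) (by simp [act]) 0 0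
  have hd : ∀ i j, (datumCostar χ ψ).arrowDefect lact ract E i 0 j 0 = 0 := fun i j =>
    hE.arrowDefect_eq_zero one_pos one_pos
  -- The first two functionals force the matrix at the source to be diagonal.
  have d10 := hd 1 0
  have d01 := hd 0 1
  simp [arrowDefect, datumCostar, Fin.sum_univ_succ, hl.one_act, hr.one_act, hr.act_zero, hT]
    at d10 d01
  have d00 := hd 0 0
  have d11 := hd 1 1
  have d20 := hd 2 0
  have d21 := hd 2 1
  have d30 := hd 3 0
  have d31 := hd 3 1
  have d40 := hd 4 0
  have d41 := hd 4 1
  simp [arrowDefect, datumCostar, Fin.sum_univ_succ, hl.one_act, hr.one_act, hl.act_zero,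
    hr.act_zero, hT, d10, d01, sub_eq_zero] at d00 d11 d20 d21 d30 d31 d40 d41
  have e11 := d20.trans d21.symm
  refine ⟨⟨E (Sum.inl 0) 0 (Sum.inl 0) 0, ?_, fun t => ?_⟩, ?_⟩
  · rintro (i | i) <;> fin_cases i
    exacts [rfl, e11.symm, d00.symm, (e11.trans d11).symm, d20.symm, d30.symm, d40.symm]
  · rw [← d30, ← e11] at d31
    rw [← d40, ← e11] at d41
    fin_cases t
    exacts [d31, d41]
  · rintro (i | i) (j | j) hij
    · fin_cases i <;> fin_cases j
      exacts [absurd rfl hij, d01, d10, absurd rfl hij]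
    · exact hST i j
    · exact hTS i j
    · exact hT i j fun h => hij (congrArg _ h)

end

end BlockDatum

end LayeredBocs

namespace LayeredBocs

/-! ### Points of the vertex algebras -/

section

variable {k B : Type u} [Field k] [CommRing B] [Algebra k B]

/-- The properties used of the generator `l` of `k[l, g(l)⁻¹]`: at every point, `l` is a constant
plus the variable in a formal power series expansion, and all but finitely many constants are values
of `l`. -/
structure IsParameter (k : Type u) {B : Type u} [Field k] [CommRing B] [Algebra k B] (l : B) :
    Prop where
  exists_powerSeries : ∀ χ : B →ₐ[k] k, ∃ σ : B →ₐ[k] PowerSeries k,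
    σ l = PowerSeries.C (χ l) + PowerSeries.X ∧ ∀ b, PowerSeries.constantCoeff (σ b) = χ b
  finite_setOf_not_value : {c : k | ¬ ∃ χ : B →ₐ[k] k, χ l = c}.Finite

lemma IsParameterVertex.exists_isParameter (hB : IsParameterVertex k B) :
    ∃ l : B, IsParameter k l := by
  obtain ⟨g, hg, ⟨e⟩⟩ := hB
  have lift : ∀ {S : Type u} [CommRing S] [Algebra k S] (s : S), IsUnit (aeval s g) →
      ∃ σ : B →ₐ[k] S, σ (e (algebraMap k[X] _ X)) = s := by
    intro S _ _ s hs
    have hu : ∀ y : Submonoid.powers g, IsUnit (aeval (R := k) s (y : k[X])) := by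
      rintro ⟨_, n, rfl⟩
      simpa using hs.pow n
    refine ⟨(IsLocalization.liftAlgHom (S := Localization.Away g) hu).comp e.symm.toAlgHom, ?_⟩
    change IsLocalization.liftAlgHom (S := Localization.Away g) hu (e.symm (e _)) = s
    rw [e.symm_apply_apply]
    exact (IsLocalization.lift_eq (S := Localization.Away g) hu X).trans (aeval_X s)
  have hom_ext : ∀ {S : Type u} [CommRing S] [Algebra k S] (σ τ : B →ₐ[k] S),
      σ (e (algebraMap k[X] _ X)) = τ (e (algebraMap k[X] _ X)) → σ = τ := by
    intro S _ _ σ τ h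
    have h1 : σ.comp e.toAlgHom = τ.comp e.toAlgHom :=
      IsLocalization.algHom_ext (Submonoid.powers g) (Polynomial.algHom_ext h)
    ext b
    simpa using AlgHom.congr_fun h1 (e.symm b)
  refine ⟨e (algebraMap k[X] _ X), fun χ => ?_, ?_⟩
  · set c := χ (e (algebraMap k[X] _ X)) with hc
    have hgc : aeval c g ≠ 0 := by
      have h1 : IsUnit (χ (e (algebraMap k[X] (Localization.Away g) g))) :=
        ((IsLocalization.Away.algebraMap_isUnit g).map e).map χ
      have h2 : (aeval c : k[X] →ₐ[k] k) =
          (χ.comp e.toAlgHom).comp (IsScalarTower.toAlgHom k k[X] (Localization.Away g)) :=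
        Polynomial.algHom_ext (by simp [hc])
      rw [h2]
      exact h1.ne_zero
    obtain ⟨ε, hε⟩ : ∃ ε : PowerSeries k →ₐ[k] k, ∀ s, ε s = PowerSeries.constantCoeff s :=
      ⟨{ PowerSeries.constantCoeff (R := k) with commutes' := fun r => by simp }, fun _ => rfl⟩
    obtain ⟨σ, hσ⟩ := lift (PowerSeries.C c + PowerSeries.X) (by
      rw [PowerSeries.isUnit_iff_constantCoeff]
      refine isUnit_iff_ne_zero.2 ?_
      rw [← hε, ← Polynomial.aeval_algHom_apply, map_add, hε, hε]
      simpa using hgc)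
    refine ⟨σ, hσ, fun b => ?_⟩
    rw [← hε]
    exact AlgHom.congr_fun (hom_ext (ε.comp σ) χ (by simp [hε, hσ, hc])) b
  · refine (g.rootSet_finite k).subset fun c hc => ?_
    rw [Polynomial.mem_rootSet]
    refine ⟨hg, ?_⟩
    by_contra h
    exact hc (lift c (isUnit_iff_ne_zero.2 h))

lemma IsParameter.exists_injective [Infinite k] {l : B} (hl : IsParameter k l) (n : ℕ) :
    ∃ χ : Fin n → B →ₐ[k] k, Function.Injective fun i => χ i l := by
  have := hl.finite_setOf_not_value.infinite_compl.to_subtype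
  let c := Infinite.natEmbedding ↥{c : k | ¬ ∃ χ : B →ₐ[k] k, χ l = c}ᶜ
  have hc : ∀ n, ∃ χ : B →ₐ[k] k, χ l = c n := fun n => not_not.1 (c n).2
  choose χ hχ using hc
  refine ⟨fun i => χ i, fun i j hij => ?_⟩
  simp only [hχ] at hij
  exact Fin.ext (c.injective (Subtype.ext hij))

lemma IsParameterVertex.finiteType (hB : IsParameterVertex k B) : Algebra.FiniteType k B := by
  obtain ⟨g, -, ⟨e⟩⟩ := hB
  have : Algebra.FiniteType k (Localization.Away g) :=
    Algebra.FiniteType.trans (S := k[X]) inferInstance inferInstance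
  exact this.equiv e

lemma IsTrivialVertex.exists_algHom (hB : IsTrivialVertex k B) : Nonempty (B →ₐ[k] k) :=
  ⟨(AlgEquiv.ofBijective (Algebra.ofId k B) hB).symm.toAlgHom⟩

lemma not_isParameterVertex_of_isTrivialVertex [Infinite k] (hB : IsTrivialVertex k B) :
    ¬ IsParameterVertex k B := by
  intro h
  obtain ⟨l, hl⟩ := h.exists_isParameter
  obtain ⟨χ, hχ⟩ := hl.exists_injective 2
  obtain ⟨c, rfl⟩ := hB.2 l
  exact absurd (hχ (a₁ := 0) (a₂ := 1) (by simp)) (by decide)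

/-- A form of the Nullstellensatz. -/
lemma exists_algHom_eq_zero_of_not_isUnit [IsAlgClosed k] [Algebra.FiniteType k B] {f : B}
    (hf : ¬ IsUnit f) : ∃ χ : B →ₐ[k] k, χ f = 0 := by
  obtain ⟨m, hm, hfm⟩ := exists_max_ideal_of_mem_nonunits hf
  let _ := Ideal.Quotient.field m
  have : Module.Finite k (B ⧸ m) := finite_of_finite_type_of_isJacobsonRing k (B ⧸ m)
  have hb := IsAlgClosed.algebraMap_bijective_of_isIntegral (k := k) (K := B ⧸ m)
  let e := AlgEquiv.ofBijective (Algebra.ofId k (B ⧸ m)) hb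
  refine ⟨e.symm.toAlgHom.comp (Ideal.Quotient.mkₐ k m), ?_⟩
  simpa using Ideal.Quotient.eq_zero_iff_mem.2 hfm

/-- If `f` is not invertible then it has a zero, at which its Taylor series has no constant
coefficient. -/
lemma exists_taylorCoeff_eq_zero [IsAlgClosed k] {C : Type u} [CommRing C] [Algebra k C]
    (hB : IsParameterVertex k B) (hC : IsParameterVertex k C) {l : B} {l' : C}
    (hl : IsParameter k l) (hl' : IsParameter k l') {f : B ⊗[k] C} (hf : ¬ IsUnit f) :
    ∃ (σ : B →ₐ[k] PowerSeries k) (τ : C →ₐ[k] PowerSeries k),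
      (∃ c, σ l = PowerSeries.C c + PowerSeries.X) ∧
      (∃ c, τ l' = PowerSeries.C c + PowerSeries.X) ∧ taylorCoeff σ τ 0 0 f = 0 := by
  have := hB.finiteType
  have := hC.finiteType
  have : Algebra.FiniteType k (B ⊗[k] C) :=
    Algebra.FiniteType.trans (R := k) (S := B) (A := B ⊗[k] C) inferInstance inferInstance
  obtain ⟨χ, hχ⟩ := exists_algHom_eq_zero_of_not_isUnit (k := k) hf
  obtain ⟨σ, hσ, hσ'⟩ := hl.exists_powerSeries (χ.comp Algebra.TensorProduct.includeLeft)
  obtain ⟨τ, hτ, hτ'⟩ := hl'.exists_powerSeries (χ.comp Algebra.TensorProduct.includeRight)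
  refine ⟨σ, τ, ⟨_, hσ⟩, ⟨_, hτ⟩, ?_⟩
  have key : taylorCoeff σ τ 0 0 = χ.toLinearMap := by
    refine TensorProduct.ext' fun x y => ?_
    rw [taylorCoeff_tmul, PowerSeries.coeff_zero_eq_constantCoeff_apply,
      PowerSeries.coeff_zero_eq_constantCoeff_apply, hσ', hτ']
    simp [← map_mul]
  rw [key]
  exact hχ

end

end LayeredBocs

namespace LayeredBocs

/-! ### Wildness -/

lemma isUnitalAction_lsmul_comp {k V W : Type*} [Field k] [AddCommGroup V] [AddCommGroup W]
    [Module k V] [Module k W] [Module (FreeAlgebra k (Fin 2)) W]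
    [IsScalarTower k (FreeAlgebra k (Fin 2)) W] :
    BlockDatum.IsUnitalAction
      fun (r : FreeAlgebra k (Fin 2)) (h : V →ₗ[k] W) => Algebra.lsmul k k W r ∘ₗ h where
  one_act h := by ext; simp
  act_zero a := by ext; simp

lemma isUnitalAction_comp_lsmul {k V W : Type*} [Field k] [AddCommGroup V] [AddCommGroup W]
    [Module k V] [Module k W] [Module (FreeAlgebra k (Fin 2)) V]
    [IsScalarTower k (FreeAlgebra k (Fin 2)) V] :
    BlockDatum.IsUnitalAction
      fun (r : FreeAlgebra k (Fin 2)) (h : V →ₗ[k] W) => h ∘ₗ Algebra.lsmul k k V r where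
  one_act h := by ext; simp
  act_zero a := by ext; simp

variable {k : Type u} [Field k] [IsAlgClosed k] {Γ Ω : Type u} [Ring Γ] [Algebra k Γ]
  [AddCommGroup Ω] [Module k Ω] [Module Γ Ω] [Module Γᵐᵒᵖ Ω] [SMulCommClass Γ Γᵐᵒᵖ Ω]
  [IsScalarTower k Γ Ω] [IsScalarTower k Γᵐᵒᵖ Ω] {A : Bocs k Γ Ω} {L : Layer A}
  {P Q : Fin L.vertices}

/-- If the differential of the first arrow is a multiple of `v` by a non-invertible coefficient,
then wildness comes from Jordan blocks at a zero of the coefficient, chosen according to its linear part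
there. -/
theorem exists_isWildOfRank_of_not_isUnit (hn : 0 < L.n) (hP : L.src ⟨0, hn⟩ = P)
    (hQ : L.tgt ⟨0, hn⟩ = Q) (hBP : IsParameterVertex k (L.B P))
    (hBQ : IsParameterVertex k (L.B Q)) (v : Ω) (f : L.B P ⊗[k] L.B Q) (hf : ¬ IsUnit f)
    (hδ : L.δ (L.a ⟨0, hn⟩) = L.coeffMul P Q f v) : ∃ n ≤ 20, A.IsWildOfRank n := by
  classical
  -- A single choice of parameters for all vertices also covers the case of a loop.
  have hpar : ∀ R, ∃ l : L.B R, IsParameterVertex k (L.B R) → IsParameter k l := fun R => by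
    by_cases h : IsParameterVertex k (L.B R)
    · exact h.exists_isParameter.imp fun _ hl _ => hl
    · exact ⟨0, fun h' => absurd h' h⟩
  choose l hl using hpar
  obtain ⟨σ, τ, ⟨c, hσ⟩, ⟨c', hτ⟩, h00⟩ :=
    exists_taylorCoeff_eq_zero hBP hBQ (hl P hBP) (hl Q hBQ) hf
  by_cases h10 : taylorCoeff σ τ 1 0 f = 0
  · by_cases h01 : taylorCoeff σ τ 0 1 f = 0
    · refine ⟨14, by norm_num, BlockDatum.isWildOfRank_of_isJordan
        (D := BlockDatum.datumTwoTwo σ τ) hn hP hQ f v hδ ?_ ?_ (by norm_num) ?_ ?_⟩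
      · refine ⟨l, ?_⟩
        rintro (i | i)
        exacts [⟨c, hσ⟩, ⟨c', hτ⟩]
      · change Function.Injective (Sum.elim ![2, 3] ![4, 5])
        decide
      · rfl
      · exact fun M N E hE hJ => BlockDatum.datumTwoTwo_diagonal isUnitalAction_lsmul_comp
          isUnitalAction_comp_lsmul h00 h10 h01 hE hJ
    · refine ⟨20, le_rfl, BlockDatum.isWildOfRank_of_isJordan
        (D := BlockDatum.datumThreeTwo σ τ) hn hP hQ f v hδ ?_ ?_ (by norm_num) ?_ ?_⟩
      · refine ⟨l, ?_⟩
        rintro (i | i)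
        exacts [⟨c, hσ⟩, ⟨c', hτ⟩]
      · change Function.Injective (Sum.elim ![2, 4, 6] ![3, 5])
        decide
      · rfl
      · exact fun M N E hE hJ => BlockDatum.datumThreeTwo_diagonal isUnitalAction_lsmul_comp
          isUnitalAction_comp_lsmul h00 h01 hE hJ
  · refine ⟨20, le_rfl, BlockDatum.isWildOfRank_of_isJordan
      (D := BlockDatum.datumTwoThree σ τ) hn hP hQ f v hδ ?_ ?_ (by norm_num) ?_ ?_⟩
    · refine ⟨l, ?_⟩
      rintro (i | i)
      exacts [⟨c, hσ⟩, ⟨c', hτ⟩]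
    · change Function.Injective (Sum.elim ![3, 5] ![2, 4, 6])
      decide
    · rfl
    · exact fun M N E hE hJ => BlockDatum.datumTwoThree_diagonal isUnitalAction_lsmul_comp
        isUnitalAction_comp_lsmul h00 h10 hE hJ

/-- If the differential of the first arrow vanishes, then wildness comes from eigenspaces at the
vertex with the parameter. -/
theorem isWildOfRank_of_δ_eq_zero (hn : 0 < L.n) (hP : L.src ⟨0, hn⟩ = P)
    (hQ : L.tgt ⟨0, hn⟩ = Q)
    (hB : IsParameterVertex k (L.B P) ∧ IsTrivialVertex k (L.B Q) ∨
      IsTrivialVertex k (L.B P) ∧ IsParameterVertex k (L.B Q))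
    (hδ : L.δ (L.a ⟨0, hn⟩) = 0) : A.IsWildOfRank 7 := by
  have : Infinite k := IsAlgClosed.instInfinite
  have hδ' : L.δ (L.a ⟨0, hn⟩) = L.coeffMul P Q 0 0 := by rw [hδ, L.coeffMul_zero]
  obtain ⟨h1, h2⟩ | ⟨h1, h2⟩ := hB
  · have hPQ : P ≠ Q := by
      rintro rfl
      exact not_isParameterVertex_of_isTrivialVertex h2 h1
    obtain ⟨l, hl⟩ := h1.exists_isParameter
    obtain ⟨χ, hχ⟩ := hl.exists_injective 5
    obtain ⟨ψ⟩ := h2.exists_algHom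
    exact BlockDatum.isWildOfRank_of_len_eq_one (BlockDatum.datumStar χ ψ) hn hP hQ 0 0 hδ'
      (by rintro (i | i) <;> rfl) (by norm_num) fun M N E hE =>
        BlockDatum.datumStar_diagonal isUnitalAction_lsmul_comp isUnitalAction_comp_lsmul hPQ hχ hE
  · have hPQ : P ≠ Q := by
      rintro rfl
      exact not_isParameterVertex_of_isTrivialVertex h1 h2
    obtain ⟨l, hl⟩ := h2.exists_isParameter
    obtain ⟨ψ, hψ⟩ := hl.exists_injective 5
    obtain ⟨χ⟩ := h1.exists_algHom
    exact BlockDatum.isWildOfRank_of_len_eq_one (BlockDatum.datumCostar χ ψ) hn hP hQ 0 0 hδ'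
      (by rintro (i | i) <;> rfl) (by norm_num) fun M N E hE =>
        BlockDatum.datumCostar_diagonal isUnitalAction_lsmul_comp isUnitalAction_comp_lsmul hPQ hψ
          hE

end LayeredBocs

theorem theorem5p1p1 {k : Type u} [Field k] [IsAlgClosed k] {Γ Ω : Type u} [Ring Γ] [Algebra k Γ]
    [AddCommGroup Ω] [Module k Ω] [Module Γ Ω] [Module Γᵐᵒᵖ Ω] [SMulCommClass Γ Γᵐᵒᵖ Ω]
    [IsScalarTower k Γ Ω] [IsScalarTower k Γᵐᵒᵖ Ω]
    (A : LayeredBocs.Bocs k Γ Ω) (L : LayeredBocs.Layer A) (hn : 0 < L.n)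
    (P Q : Fin L.vertices) (hP : L.src ⟨0, hn⟩ = P) (hQ : L.tgt ⟨0, hn⟩ = Q) :
    (LayeredBocs.IsParameterVertex k (L.B P) → LayeredBocs.IsParameterVertex k (L.B Q) →
      ∀ (hm : 0 < L.m) (f : L.B P ⊗[k] L.B Q), ¬ IsUnit f →
        L.δ (L.a ⟨0, hn⟩) = L.coeffMul P Q f (L.v ⟨0, hm⟩) →
          A.IsWild ∧ ∃ n ≤ 20, A.IsWildOfRank n) ∧
    (LayeredBocs.IsParameterVertex k (L.B P) ∧ LayeredBocs.IsTrivialVertex k (L.B Q) ∨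
        LayeredBocs.IsTrivialVertex k (L.B P) ∧ LayeredBocs.IsParameterVertex k (L.B Q) →
      L.δ (L.a ⟨0, hn⟩) = 0 →
          A.IsWild ∧ ∃ n ≤ 20, A.IsWildOfRank n) := by
  refine ⟨fun hBP hBQ hm f hf hδ => ?_, fun hB hδ => ?_⟩
  · obtain ⟨n, hn20, hw⟩ :=
      LayeredBocs.exists_isWildOfRank_of_not_isUnit hn hP hQ hBP hBQ (L.v ⟨0, hm⟩) f hf hδ
    exact ⟨⟨n, hw⟩, n, hn20, hw⟩
  · have hw := LayeredBocs.isWildOfRank_of_δ_eq_zero hn hP hQ hB hδ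
    exact ⟨⟨7, hw⟩, 7, by norm_num, hw⟩
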